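/- Let $\pi=\mathbb Z^n$ and let $$\mathcal C:\quad 0\to C_m\xrightarrow{\partial_m}C_{m-1}\to\dots\xrightarrow{\partial_1}C_0\to 0$$ be a finitely generated based free $\mathbb Z[\pi]$-complex, i.e. a chain complex in which every $C_j$ is a free $\mathbb Z[\pi]$-module with a preferred finite base. For a subgroup $\Gamma\le\pi$ of finite index let $\mathcal C_\Gamma=\mathbb Z[\pi/\Gamma]\otimes_{\mathbb Z[\pi]}\mathcal C$, a finitely generated based free $\mathbb Z$-complex whose preferred base in degree $j$ consists of the elements $a\otimes e$, with $a\in\pi/\Gamma$ and $e$ in the preferred base of $C_j$. For a finitely generated based free $\mathbb Z$-complex $\mathcal E=(E_j,d_j)$ equip $E_k\otimes\mathbb C$ with the Hermitian product for which the preferred base is orthonormal. For a subgroup $\Lambda\subseteq E_k$ with $\mathbb Z$-basis $v_1,\dots,v_l$ put $\operatorname{vol}(\Lambda)=|\det((v_i,v_j))_{i,j=1}^l|^{1/2}$ (so $\operatorname{vol}(0)=1$). Let $Z_k=\ker d_k$, $B_k=\operatorname{im} d_{k+1}$, $\overline B_k=(B_k\otimes\mathbb C)\cap E_k$, and define the regulator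 $$R_k(\mathcal E)=\operatorname{vol}(H_k(\mathcal E)_{\mathrm{free}}):=\frac{\operatorname{vol}(Z_k)}{\operatorname{vol}(\overline B_k)}.$$ Fix a finite set $S$ of generators of $\pi$ with word length $l_S$, and put $\langle\Gamma\rangle=\min\{l_S(x)\mid x\in\Gamma\setminus\{0\}\}$ (with $\langle\Gamma\rangle=\infty$ if $\Gamma=0$). Theorem. Suppose that for some $k\ge 0$ the $k$-th $L^2$-homology of $\mathcal C$ vanishes, in the sense that $H_k(\mathcal C\otimes_{\mathbb Z[\pi]}F)=0$, where $F$ is the fraction field of $\mathbb Z[\pi]$. Then $$\lim_{\langle\Gamma\rangle\to\infty,\ [\pi:\Gamma]<\infty}\frac{\ln R_k(\mathcal C_\Gamma)}{[\pi:\Gamma]}=0,$$ that is, for every $\varepsilon>0$ there is $N$ such that $|\ln R_k(\mathcal C_\Gamma)|<\varepsilon\,[\pi:\Gamma]$ for every subgroup $\Gamma\le\pi$ of finite index with $\langle\Gamma\rangle\ge N$. -/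

import Mathlib

open Filter Topology

noncomputable section

/-! ### Based free chain complexes -/

/-- A finitely generated based free chain complex
`0 → C_m → C_{m-1} → ⋯ → C_1 → C_0 → 0` over a commutative ring `R`.
The preferred base of `C_j` is indexed by the finite type `ι j`, so that `C_j = (ι j → R)`, and the
boundary map `C_{j+1} → C_j` is given by its matrix `d j` in the preferred bases. -/
structure BasedFreeComplex (R : Type*) [CommRing R] where
  /-- index type of the preferred base of `C_j` -/
  ι : ℕ → Type
  [fintype : ∀ j, Fintype (ι j)]
  /-- matrix of the boundary map `C_{j+1} → C_j` -/
  d : ∀ j, Matrix (ι j) (ι (j + 1)) R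
  d_mul_d : ∀ j, d j * d (j + 1) = 0
  bounded : ∃ m, ∀ j, m < j → IsEmpty (ι j)

namespace BasedFreeComplex

attribute [instance] BasedFreeComplex.fintype

variable {R : Type*} [CommRing R]

/-- The cycles `Z_k = ker (C_k → C_{k-1})`, where `C_{-1} = 0`. -/
def cycles (C : BasedFreeComplex R) : ∀ k, Submodule R (C.ι k → R)
  | 0 => ⊤
  | k + 1 => LinearMap.ker (C.d k).mulVecLin

/-- The boundaries `B_k = im (C_{k+1} → C_k)`. -/
def boundaries (C : BasedFreeComplex R) (k : ℕ) : Submodule R (C.ι k → R) :=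
  LinearMap.range (C.d k).mulVecLin

theorem boundaries_le_cycles (C : BasedFreeComplex R) (k : ℕ) : C.boundaries k ≤ C.cycles k := by
  cases k with
  | zero => exact le_top
  | succ k =>
    rintro _ ⟨x, rfl⟩
    simp [cycles, Matrix.mulVec_mulVec, C.d_mul_d k]

/-- The homology module `H_k = Z_k / B_k`. -/
abbrev homology (C : BasedFreeComplex R) (k : ℕ) : Type _ :=
  C.cycles k ⧸ (C.boundaries k).submoduleOf (C.cycles k)

/-- Extension of scalars `S ⊗_R C` along a ring homomorphism `R → S`, with the induced bases. -/
def baseChange {S : Type*} [CommRing S] (φ : R →+* S) (C : BasedFreeComplex R) :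
    BasedFreeComplex S where
  ι := C.ι
  fintype := C.fintype
  d j := (C.d j).map φ
  d_mul_d j := by
    rw [← Matrix.map_mul, C.d_mul_d j]
    exact Matrix.map_zero _ (map_zero φ)
  bounded := C.bounded

/-- Restriction of scalars from an `R`-algebra `S` that is free over `R` with finite basis `b`:
the module `C_j`, with `S`-base `(e_i)`, gets the `R`-base `(b_a e_i)`, and each matrix entry
`s : S` is replaced by the matrix of multiplication by `s` on `S` in the basis `b`. -/
def restrictScalars {S : Type*} [CommRing S] [Algebra R S] {κ : Type} [Fintype κ] [DecidableEq κ]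
    (b : Module.Basis κ R S) (C : BasedFreeComplex S) : BasedFreeComplex R where
  ι j := C.ι j × κ
  d j := Matrix.of fun p q => Algebra.leftMulMatrix b (C.d j p.1 q.1) p.2 q.2
  d_mul_d j := by
    ext p q
    have h := congrArg (fun s => Algebra.leftMulMatrix b s p.2 q.2)
      (congrFun (congrFun (C.d_mul_d j) p.1) q.1)
    simp only [Matrix.mul_apply, map_sum, map_mul, Matrix.sum_apply, Matrix.zero_apply,
      map_zero] at h
    rw [Matrix.mul_apply, Fintype.sum_prod_type]
    exact h
  bounded := by
    obtain ⟨m, hm⟩ := C.bounded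
    exact ⟨m, fun j hj => by have := hm j hj; infer_instance⟩

end BasedFreeComplex

/-! ### Volumes of integral lattices -/

section Volume

variable {ι : Type} [Fintype ι]

/-- The inclusion of the fundamental lattice `ℤ^ι` into the based Hermitian space `ℂ^ι`. -/
def toHermitian : (ι → ℤ) →ₗ[ℤ] EuclideanSpace ℂ ι where
  toFun x := WithLp.toLp 2 fun i => (x i : ℂ)
  map_add' x y := by ext i; simp
  map_smul' c x := by ext i; simp

/-- The volume `|det ((v_i, v_j))_{i,j}|^{1/2}` of an integral lattice `Λ ⊆ ℤ^ι ⊆ ℂ^ι`, where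
`(v_i)` is a `ℤ`-basis of `Λ`. -/
def latticeVol (Λ : Submodule ℤ (ι → ℤ)) : ℝ :=
  √ ‖(Matrix.gram ℂ fun i => toHermitian (Module.finBasis ℤ Λ i : ι → ℤ)).det‖

theorem gram_toHermitian {κ : Type*} (v : κ → ι → ℤ) :
    Matrix.gram ℂ (fun i => toHermitian (v i)) =
      (Matrix.of v * (Matrix.of v).transpose).map (Int.castRingHom ℂ) := by
  ext i j
  simp [Matrix.gram_apply, toHermitian, PiLp.inner_apply, Matrix.mul_apply, mul_comm]

/-- The volume does not depend on the choice of the basis. -/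
theorem latticeVol_eq (Λ : Submodule ℤ (ι → ℤ)) {κ : Type*} [Fintype κ] [DecidableEq κ]
    (b : Module.Basis κ ℤ Λ) :
    latticeVol Λ = √ ‖(Matrix.gram ℂ fun i => toHermitian (b i : ι → ℤ)).det‖ := by
  let e : κ ≃ Fin (Module.finrank ℤ Λ) := b.indexEquiv (Module.finBasis ℤ Λ)
  let c := Module.finBasis ℤ Λ
  let b' := b.reindex e
  have h1 : (Matrix.gram ℂ fun i => toHermitian (b i : ι → ℤ)).det =
      (Matrix.gram ℂ fun i => toHermitian (b' i : ι → ℤ)).det := by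
    rw [← Matrix.det_submatrix_equiv_self e
      (Matrix.gram ℂ fun i => toHermitian (b' i : ι → ℤ))]
    congr 1
    ext i j
    simp [Matrix.gram_apply, b']
  let P := c.toMatrix b'
  have hP : (P.det) ^ 2 = 1 := by
    have h : P.det * (b'.toMatrix c).det = 1 := by
      rw [← Matrix.det_mul, Module.Basis.toMatrix_mul_toMatrix_flip, Matrix.det_one]
    rcases Int.isUnit_iff.mp (IsUnit.of_mul_eq_one _ h) with h | h <;> simp [h]
  have h2 : Matrix.of (fun i => (b' i : ι → ℤ)) =
      P.transpose * Matrix.of (fun i => (c i : ι → ℤ)) := by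
    ext i x
    have := congrFun (congrArg Subtype.val (c.sum_toMatrix_smul_self b' i)) x
    simp only [Matrix.mul_apply, Matrix.transpose_apply, Matrix.of_apply, P]
    refine this.symm.trans ?_
    simp [-Module.Basis.sum_toMatrix_smul_self]
  have h3 : (Matrix.of (fun i => (b' i : ι → ℤ)) *
      (Matrix.of (fun i => (b' i : ι → ℤ))).transpose).det =
      (Matrix.of (fun i => (c i : ι → ℤ)) *
      (Matrix.of (fun i => (c i : ι → ℤ))).transpose).det := by
    rw [h2, Matrix.transpose_mul, Matrix.transpose_transpose, Matrix.mul_assoc,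
      ← Matrix.mul_assoc _ _ P, Matrix.det_mul, Matrix.det_mul, Matrix.det_transpose]
    linear_combination (Matrix.of (fun i => (c i : ι → ℤ)) *
      (Matrix.of (fun i => (c i : ι → ℤ))).transpose).det * hP
  rw [h1, latticeVol, gram_toHermitian, gram_toHermitian, ← RingHom.mapMatrix_apply,
    ← RingHom.mapMatrix_apply, ← RingHom.map_det, ← RingHom.map_det, h3]

/-- The saturation `(Λ ⊗ ℂ) ∩ ℤ^ι` of an integral lattice `Λ`. -/
def saturation (Λ : Submodule ℤ (ι → ℤ)) : Submodule ℤ (ι → ℤ) :=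
  ((Submodule.span ℂ (toHermitian '' (Λ : Set (ι → ℤ)))).restrictScalars ℤ).comap toHermitian

end Volume

/-- The regulator `R_k(E) = vol(H_k(E)_free) = vol(Z_k) / vol(B̄_k)` of a based free `ℤ`-complex,
where `B̄_k = (B_k ⊗ ℂ) ∩ E_k`. -/
def BasedFreeComplex.regulator (E : BasedFreeComplex ℤ) (k : ℕ) : ℝ :=
  latticeVol (E.cycles k) / latticeVol (saturation (E.boundaries k))

/-! ### Complexes over `ℤ[ℤⁿ]` and their quotients -/

open Classical in
/-- For a subgroup `Γ` of finite index in `ℤⁿ`, the based free `ℤ`-complex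
`C_Γ = ℤ[ℤⁿ/Γ] ⊗_{ℤ[ℤⁿ]} C`, with preferred base the elements `a e_i`, where `a ∈ ℤⁿ/Γ` and
`(e_i)` is the preferred base. -/
def BasedFreeComplex.quotientComplex {n : ℕ}
    (C : BasedFreeComplex (AddMonoidAlgebra ℤ (Fin n → ℤ)))
    (Γ : AddSubgroup (Fin n → ℤ)) [Γ.FiniteIndex] : BasedFreeComplex ℤ :=
  letI : Fintype ((Fin n → ℤ) ⧸ Γ) := Fintype.ofFinite _
  (C.baseChange (AddMonoidAlgebra.mapDomainRingHom ℤ (QuotientAddGroup.mk' Γ))).restrictScalars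
    (AddMonoidAlgebra.basis ((Fin n → ℤ) ⧸ Γ) ℤ)

/-- The word length `l_S(x)`: the least length of an expression of `x` as a sum of elements of
`S ∪ -S`. -/
def wordLength {G : Type*} [AddGroup G] (S : Set G) (x : G) : ℕ∞ :=
  ⨅ (l : List G) (_ : ∀ s ∈ l, s ∈ S ∨ -s ∈ S) (_ : l.sum = x), (l.length : ℕ∞)

/-- `⟨Γ⟩ = min {l_S(x) | x ∈ Γ ∖ {0}}` (and `∞` if `Γ` is trivial). -/
def girth {G : Type*} [AddGroup G] (S : Set G) (Γ : AddSubgroup G) : ℕ∞ :=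
  ⨅ (x : G) (_ : x ∈ Γ) (_ : x ≠ 0), wordLength S x

end

open Filter Topology

noncomputable section

/-! ### Gram determinants of integral vectors -/

/-! Let $A$ be the boundary map into degree $k$ and $D$ the one out of it. Over $F$ the vanishing of
homology gives a contracting homotopy; clearing denominators, $AP+QD=p$ with $0\neq p\in\mathbb
Z[\pi]$ (`exists_matrix_homotopy_of_fractionRing`). Over a finite quotient $G=\pi/\Gamma$ the image
of $p$ therefore carries cycles into boundaries, so rational homology can live only at characters of
$G$ where $p$ vanishes. By a weak form of Mann's theorem (`exists_pow_factorial_eq_of_sum_eq_zero`)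
such a character is trivial on one of finitely many nonzero $a\in\pi$ depending only on $p$. Hence
the image of $p$ and the sums over the cyclic subgroups $\langle a\rangle\le G$ generate an ideal
containing a nonzero integer (`exists_intCast_mem_span_normElement`).

Multiplication by the sum over $\langle a\rangle$ is expressed through the indicator vectors of the
cosets of $\langle a\rangle$. So, up to finite index, $Z$ lies in $B$ plus the span of these
vectors, and a cycle orthogonal to all of them is rationally a boundary. Adjoining a vector to a
lattice, or cutting by its orthogonal complement, multiplies the squared volume by at most its
squared norm. Comparing $Z$ with $\overline B$ through a larger and through a smaller lattice gives
$|\ln R|\le\sum_v(\ln L+\ln|v|^2)$ with $L$ independent of $\Gamma$ (`abs_log_latticeVol_div_le`).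

Each $a$ contributes $\operatorname{rk}C_k\cdot|G|/\operatorname{ord}(a)$ vectors of squared norm
$\operatorname{ord}(a)$. After division by $|G|$ what remains is a finite sum of terms $(\ln
L+\ln\operatorname{ord}(a))/\operatorname{ord}(a)$ up to a constant factor, and large girth forces
$\operatorname{ord}(a)\to\infty$. -/

open Matrix in
theorem det_gram_pos {ι κ : Type*} [Fintype ι] [Fintype κ] [DecidableEq κ] {v : κ → ι → ℤ}
    (hv : LinearIndependent ℤ v) : 0 < (of v * (of v)ᵀ).det := by
  have h0 : 0 ≤ (of v * (of v)ᵀ).det := by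
    have h := (posSemidef_self_mul_conjTranspose ((of v).map (Int.castRingHom ℝ))).det_nonneg
    have h2 : (of v).map (Int.castRingHom ℝ) * ((of v).map (Int.castRingHom ℝ))ᴴ =
        (Int.castRingHom ℝ).mapMatrix (of v * (of v)ᵀ) := by
      ext i j
      simp [mul_apply]
    rw [h2, ← RingHom.map_det] at h
    simpa using h
  refine lt_of_le_of_ne h0 fun h => ?_
  obtain ⟨x, hx, hx0⟩ := Matrix.exists_vecMul_eq_zero_iff.mpr h.symm
  have h3 : (x ᵥ* of v) ⬝ᵥ (x ᵥ* of v) = 0 := by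
    have := congrArg (fun y => y ⬝ᵥ x) hx0
    simp only [zero_dotProduct] at this
    rw [← vecMul_vecMul, vecMul_transpose, ← vecMul_transpose, ← dotProduct_mulVec,
      mulVec_transpose] at this
    exact this
  have h4 : x ᵥ* of v = 0 := dotProduct_self_eq_zero.mp h3
  apply hx
  ext i
  refine Fintype.linearIndependent_iff.mp hv x ?_ i
  rw [← h4]
  ext j
  simp [vecMul, dotProduct]

open Matrix in
/-- Adjoining a vector `w` to a family multiplies its Gram determinant by the squared distance
`ρ` of `w` from the span of the family. -/
theorem exists_det_gram_sumElim {ι κ : Type*} [Fintype ι] [Fintype κ] [DecidableEq κ]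
    {v : κ → ι → ℤ} (hv : LinearIndependent ℤ v) (w : ι → ℤ) :
    ∃ ρ : ℝ, (((of (Sum.elim v fun _ : Unit => w) *
        (of (Sum.elim v fun _ : Unit => w))ᵀ).det : ℤ) : ℝ) =
          ((of v * (of v)ᵀ).det : ℤ) * ρ ∧ ρ ≤ ((w ⬝ᵥ w : ℤ) : ℝ) ∧
        ∀ y : ι → ℤ, (∀ i, v i ⬝ᵥ y = 0) →
          ((w ⬝ᵥ y : ℤ) : ℝ) ^ 2 ≤ ρ * ((y ⬝ᵥ y : ℤ) : ℝ) := by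
  set V : Matrix κ ι ℝ := (of v).map (Int.castRingHom ℝ) with hV
  set w' : ι → ℝ := fun i => (w i : ℝ) with hw'
  have hA : V * Vᵀ = (Int.castRingHom ℝ).mapMatrix (of v * (of v)ᵀ) := by
    ext i j
    simp [mul_apply, V]
  have hdet : (V * Vᵀ).det = ((of v * (of v)ᵀ).det : ℤ) := by
    rw [hA, ← RingHom.map_det]
    simp
  have hunit : IsUnit (V * Vᵀ).det := by
    rw [hdet]
    exact isUnit_iff_ne_zero.mpr (by exact_mod_cast (det_gram_pos hv).ne')
  -- `c` holds the coefficients of the orthogonal projection of `w'` to the row space of `V`; `r` is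
  -- the residual, and $\rho=|r|^2$.
  let c : κ → ℝ := (V * Vᵀ)⁻¹ *ᵥ (V *ᵥ w')
  let r : ι → ℝ := w' - Vᵀ *ᵥ c
  have hVr : V *ᵥ r = 0 := by
    simp only [r, c, mulVec_sub, mulVec_mulVec]
    rw [← Matrix.mul_assoc, ← Matrix.mul_assoc, mul_nonsing_inv _ hunit, Matrix.one_mul, sub_self]
  have hcr : ∀ y : ι → ℝ, V *ᵥ y = 0 → (Vᵀ *ᵥ c) ⬝ᵥ y = 0 := by
    intro y hy
    rw [mulVec_transpose, ← dotProduct_mulVec, hy, dotProduct_zero]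
  have hw_eq : w' = r + Vᵀ *ᵥ c := by simp [r]
  have hww : ((w ⬝ᵥ w : ℤ) : ℝ) = w' ⬝ᵥ w' := by simp [dotProduct, w']
  refine ⟨r ⬝ᵥ r, ?_, ?_, ?_⟩
  -- The bordered Gram determinant is evaluated by its Schur complement, which is $|r|^2$.
  · let := invertibleOfIsUnitDet _ hunit
    have hblock : (Int.castRingHom ℝ).mapMatrix (of (Sum.elim v fun _ : Unit => w) *
        (of (Sum.elim v fun _ : Unit => w))ᵀ) =
        fromBlocks (V * Vᵀ) (of fun i _ => (V *ᵥ w') i) (of fun _ i => (V *ᵥ w') i)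
          (of fun _ _ => w' ⬝ᵥ w') := by
      ext i j
      rcases i with i | i <;> rcases j with j | j <;>
        simp [mul_apply, V, mulVec, dotProduct, w', mul_comm]
    have hcast : ∀ z : ℤ, (z : ℝ) = Int.castRingHom ℝ z := fun _ => rfl
    rw [← hdet, hcast, RingHom.map_det, hblock, det_fromBlocks₁₁]
    congr 1
    rw [det_unique, Matrix.sub_apply, of_apply]
    have h1 : ((of fun (_ : Unit) i => (V *ᵥ w') i) * ⅟(V * Vᵀ) * (of fun i (_ : Unit) => (V *ᵥ w') i)
        : Matrix Unit Unit ℝ) default default = (V *ᵥ w') ⬝ᵥ c := by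
      rw [Matrix.mul_assoc, mul_apply, dotProduct]
      simp only [c, of_apply, invOf_eq_nonsing_inv]
      rfl
    rw [h1]
    have h2 : (V *ᵥ w') ⬝ᵥ c = w' ⬝ᵥ (Vᵀ *ᵥ c) := by
      rw [dotProduct_comm, dotProduct_mulVec, dotProduct_comm, mulVec_transpose]
    have h3 : r ⬝ᵥ r = w' ⬝ᵥ r := by
      conv_rhs => rw [hw_eq]
      rw [add_dotProduct, hcr r hVr, add_zero]
    rw [h2, h3]
    simp [r, dotProduct_sub]
  · rw [hww, hw_eq, add_dotProduct, dotProduct_add, dotProduct_add, hcr r hVr,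
      dotProduct_comm r (Vᵀ *ᵥ c), hcr r hVr]
    have : 0 ≤ (Vᵀ *ᵥ c) ⬝ᵥ (Vᵀ *ᵥ c) := Finset.sum_nonneg fun i _ => mul_self_nonneg _
    linarith
  -- For `y` orthogonal to the family, `w` may be replaced by `r`; Cauchy–Schwarz then applies.
  · intro y hy
    set y' : ι → ℝ := fun i => (y i : ℝ) with hy'
    have hVy : V *ᵥ y' = 0 := by
      ext i
      have := congrArg (Int.cast : ℤ → ℝ) (hy i)
      simpa [V, mulVec, dotProduct, y'] using this
    have h1 : ((w ⬝ᵥ y : ℤ) : ℝ) = r ⬝ᵥ y' := by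
      have : ((w ⬝ᵥ y : ℤ) : ℝ) = w' ⬝ᵥ y' := by simp [dotProduct, w', y']
      rw [this, hw_eq, add_dotProduct, hcr y' hVy, add_zero]
    have h2 : ((y ⬝ᵥ y : ℤ) : ℝ) = y' ⬝ᵥ y' := by simp [dotProduct, y']
    rw [h1, h2]
    have := Finset.sum_mul_sq_le_sq_mul_sq Finset.univ r y'
    simpa [dotProduct, pow_two] using this

/-! ### Volumes of lattices and of sublattices -/

section LatticeVolume

variable {ι : Type} [Fintype ι]

open Matrix in
theorem latticeVol_sq (Λ : Submodule ℤ (ι → ℤ)) {κ : Type*} [Fintype κ] [DecidableEq κ]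
    (b : Module.Basis κ ℤ Λ) :
    latticeVol Λ ^ 2 = (((of fun i => (b i : ι → ℤ)) * (of fun i => (b i : ι → ℤ))ᵀ).det : ℤ) := by
  have hv : LinearIndependent ℤ fun i => (b i : ι → ℤ) :=
    b.linearIndependent.map' Λ.subtype Λ.ker_subtype
  rw [latticeVol_eq Λ b, Real.sq_sqrt (norm_nonneg _), gram_toHermitian,
    ← RingHom.mapMatrix_apply, ← RingHom.map_det, eq_intCast, Complex.norm_intCast, abs_of_pos]
  exact_mod_cast det_gram_pos hv

theorem latticeVol_pos (Λ : Submodule ℤ (ι → ℤ)) : 0 < latticeVol Λ := by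
  have h := latticeVol_sq Λ (Module.finBasis ℤ Λ)
  have hv : LinearIndependent ℤ fun i => (Module.finBasis ℤ Λ i : ι → ℤ) :=
    (Module.finBasis ℤ Λ).linearIndependent.map' Λ.subtype Λ.ker_subtype
  have h2 : 0 < latticeVol Λ ^ 2 := by
    rw [h]
    exact_mod_cast det_gram_pos hv
  exact lt_of_le_of_ne (Real.sqrt_nonneg _) fun h0 => by
    rw [← h0] at h2
    simp at h2

theorem finrank_eq_of_smul_mem {Λ Λ' : Submodule ℤ (ι → ℤ)} (h : Λ ≤ Λ')
    (hs : ∀ x ∈ Λ', ∃ m : ℤ, m ≠ 0 ∧ m • x ∈ Λ) : Module.finrank ℤ Λ = Module.finrank ℤ Λ' := by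
  have h1 := Submodule.finrank_quotient_add_finrank (Λ.submoduleOf Λ')
  have h2 : Module.finrank ℤ (Λ' ⧸ Λ.submoduleOf Λ') = 0 := by
    rw [Module.finrank_eq_zero_iff_isTorsion]
    intro x
    obtain ⟨x, rfl⟩ := Submodule.Quotient.mk_surjective _ x
    obtain ⟨m, hm, hx⟩ := hs x x.2
    refine ⟨⟨m, mem_nonZeroDivisors_of_ne_zero hm⟩, ?_⟩
    rw [Submonoid.mk_smul, ← Submodule.Quotient.mk_smul, Submodule.Quotient.mk_eq_zero]
    exact hx
  rw [h2, zero_add, (Submodule.submoduleOfEquivOfLe h).finrank_eq] at h1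
  exact h1

-- The ranks agree, so a basis of `Λ` is a square integral matrix `P` times a basis of `Λ'`; the
-- Gram determinants differ by the factor $(\det P)^2\ge 1$.
open Matrix in
theorem latticeVol_le_of_smul_mem {Λ Λ' : Submodule ℤ (ι → ℤ)} (h : Λ ≤ Λ')
    (hs : ∀ x ∈ Λ', ∃ m : ℤ, m ≠ 0 ∧ m • x ∈ Λ) : latticeVol Λ' ≤ latticeVol Λ := by
  let b := Module.finBasis ℤ Λ
  let c := (Module.finBasis ℤ Λ').reindex (finCongr (finrank_eq_of_smul_mem h hs).symm)
  have hb : LinearIndependent ℤ fun i => (b i : ι → ℤ) :=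
    b.linearIndependent.map' Λ.subtype Λ.ker_subtype
  have hc : LinearIndependent ℤ fun i => (c i : ι → ℤ) :=
    c.linearIndependent.map' Λ'.subtype Λ'.ker_subtype
  let P : Matrix _ _ ℤ := of fun i j => c.repr ⟨b i, h (b i).2⟩ j
  have hP : (of fun i => (b i : ι → ℤ)) = P * of fun i => (c i : ι → ℤ) := by
    ext i x
    have := congrFun (congrArg Subtype.val (c.sum_repr ⟨b i, h (b i).2⟩)) x
    simp only [mul_apply, of_apply, P]
    refine this.symm.trans ?_
    simp [-Module.Basis.sum_repr]
  have hdet : ((of fun i => (b i : ι → ℤ)) * (of fun i => (b i : ι → ℤ))ᵀ).det =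
      P.det ^ 2 * ((of fun i => (c i : ι → ℤ)) * (of fun i => (c i : ι → ℤ))ᵀ).det := by
    rw [hP, transpose_mul, Matrix.mul_assoc, ← Matrix.mul_assoc _ _ Pᵀ, det_mul, det_mul,
      det_transpose]
    ring
  have hb' := det_gram_pos hb
  have hc' := det_gram_pos hc
  have hle : ((of fun i => (c i : ι → ℤ)) * (of fun i => (c i : ι → ℤ))ᵀ).det ≤
      ((of fun i => (b i : ι → ℤ)) * (of fun i => (b i : ι → ℤ))ᵀ).det := by
    rw [hdet] at hb' ⊢
    have : 0 < P.det ^ 2 := by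
      by_contra hcon
      nlinarith [sq_nonneg P.det]
    nlinarith
  have h2 : latticeVol Λ' ^ 2 ≤ latticeVol Λ ^ 2 := by
    rw [latticeVol_sq Λ b, latticeVol_sq Λ' c]
    exact_mod_cast hle
  exact (sq_le_sq₀ (Real.sqrt_nonneg _) (Real.sqrt_nonneg _)).mp h2

-- Both bounds on `ρ` are used: the upper one when a generator is adjoined, the lower one when a
-- lattice is cut by the orthogonal complement of `y`.
open Matrix in
theorem exists_latticeVol_sup_span_singleton (Λ : Submodule ℤ (ι → ℤ)) (w : ι → ℤ)
    (hw : ∀ m : ℤ, m • w ∈ Λ → m = 0) :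
    Module.finrank ℤ ↥(Λ ⊔ Submodule.span ℤ {w}) = Module.finrank ℤ Λ + 1 ∧
    ∃ ρ : ℝ, latticeVol (Λ ⊔ Submodule.span ℤ {w}) ^ 2 = latticeVol Λ ^ 2 * ρ ∧
      ρ ≤ ((w ⬝ᵥ w : ℤ) : ℝ) ∧ ∀ y : ι → ℤ, (∀ x ∈ Λ, x ⬝ᵥ y = 0) →
        ((w ⬝ᵥ y : ℤ) : ℝ) ^ 2 ≤ ρ * ((y ⬝ᵥ y : ℤ) : ℝ) := by
  let b := Module.finBasis ℤ Λ
  have hb : LinearIndependent ℤ fun i => (b i : ι → ℤ) :=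
    b.linearIndependent.map' Λ.subtype Λ.ker_subtype
  have hspan : Submodule.span ℤ (Set.range fun i => (b i : ι → ℤ)) = Λ := by
    have := congrArg (Submodule.map Λ.subtype) b.span_eq
    rw [Submodule.map_span, Submodule.map_top, Submodule.range_subtype, ← Set.range_comp] at this
    exact this
  have hli : LinearIndependent ℤ (Sum.elim (fun i => (b i : ι → ℤ)) fun _ : Unit => w) := by
    refine hb.sum_type ?_ ?_
    · rw [linearIndependent_unique_iff]
      rintro rfl
      exact one_ne_zero (hw 1 (by simp))
    · rw [hspan, Set.range_const, Submodule.disjoint_def]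
      intro x hx hx2
      obtain ⟨m, rfl⟩ := Submodule.mem_span_singleton.mp hx2
      rw [hw m hx, zero_smul]
  have hspan2 : Submodule.span ℤ (Set.range (Sum.elim (fun i => (b i : ι → ℤ)) fun _ : Unit => w)) =
      Λ ⊔ Submodule.span ℤ {w} := by
    rw [Set.Sum.elim_range, Submodule.span_union, hspan, Set.range_const]
  let B := (Module.Basis.span hli).map (LinearEquiv.ofEq _ _ hspan2)
  have hB : (fun i => (B i : ι → ℤ)) = Sum.elim (fun i => (b i : ι → ℤ)) fun _ : Unit => w := by
    ext i : 1
    simp [B, Module.Basis.span_apply]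
  refine ⟨?_, ?_⟩
  · rw [Module.finrank_eq_card_basis B]
    simp
  · obtain ⟨ρ, h1, h2, h3⟩ := exists_det_gram_sumElim hb w
    refine ⟨ρ, ?_, h2, fun y hy => h3 y fun i => hy _ (b i).2⟩
    rw [latticeVol_sq _ B, latticeVol_sq _ b, hB, h1]

open Matrix in
/-- A lattice generated up to finite index by `Λ` and finitely many vectors has volume at most that
of `Λ` times the norms of some of these vectors. -/
theorem exists_latticeVol_le_of_sup_span {τ : Type*} (y : τ → ι → ℤ) (Y : Finset τ)
    {Λ Λ' : Submodule ℤ (ι → ℤ)} (h : Λ ≤ Λ') (hY : ∀ t ∈ Y, y t ∈ Λ')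
    (hs : ∀ x ∈ Λ', ∃ m : ℤ, m ≠ 0 ∧ m • x ∈ Λ ⊔ Submodule.span ℤ (y '' Y)) :
    ∃ s ⊆ Y, Module.finrank ℤ Λ + s.card = Module.finrank ℤ Λ' ∧
      latticeVol Λ' ^ 2 ≤ latticeVol Λ ^ 2 * ∏ t ∈ s, ((y t ⬝ᵥ y t : ℤ) : ℝ) := by
  classical
  induction Y using Finset.induction_on generalizing Λ with
  | empty =>
    have hs' : ∀ x ∈ Λ', ∃ m : ℤ, m ≠ 0 ∧ m • x ∈ Λ := by simpa using hs
    refine ⟨∅, le_rfl, by simpa using finrank_eq_of_smul_mem h hs', ?_⟩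
    have := latticeVol_le_of_smul_mem h hs'
    simpa using pow_le_pow_left₀ (latticeVol_pos _).le this 2
  | insert t Y ht ih =>
    have hle : Λ ⊔ Submodule.span ℤ {y t} ≤ Λ' :=
      sup_le h (by simpa using hY t (Finset.mem_insert_self _ _))
    obtain ⟨s, hsY, hcard, hvol⟩ := ih hle (fun t' ht' => hY t' (Finset.mem_insert_of_mem ht'))
      (by
        intro x hx
        obtain ⟨m, hm, hmx⟩ := hs x hx
        refine ⟨m, hm, ?_⟩
        rwa [Finset.coe_insert, Set.image_insert_eq, Submodule.span_insert, ← sup_assoc] at hmx)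
    by_cases hw : ∀ m : ℤ, m • y t ∈ Λ → m = 0
    · obtain ⟨hr, ρ, hρ, hρ2, -⟩ := exists_latticeVol_sup_span_singleton Λ (y t) hw
      have hts : t ∉ s := fun hts => ht (hsY hts)
      refine ⟨insert t s, Finset.insert_subset_insert _ hsY, ?_, ?_⟩
      · rw [Finset.card_insert_of_notMem hts]
        omega
      · rw [Finset.prod_insert hts]
        refine hvol.trans ?_
        rw [hρ, mul_assoc]
        gcongr
        refine Finset.prod_nonneg fun t' _ => ?_
        exact_mod_cast Finset.sum_nonneg fun i _ => mul_self_nonneg _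
    -- Here `y t` is torsion modulo `Λ`: adjoining it keeps the rank and does not increase the
    -- volume, so `t` is left out of `s`.
    · push Not at hw
      obtain ⟨m, hm, hm0⟩ := hw
      have hs' : ∀ x ∈ Λ ⊔ Submodule.span ℤ {y t}, ∃ m : ℤ, m ≠ 0 ∧ m • x ∈ Λ := by
        intro x hx
        obtain ⟨a, ha, b, hb, rfl⟩ := Submodule.mem_sup.mp hx
        obtain ⟨c, rfl⟩ := Submodule.mem_span_singleton.mp hb
        refine ⟨m, hm0, ?_⟩
        rw [smul_add, smul_comm]
        exact add_mem (Λ.smul_mem _ ha) (Λ.smul_mem _ hm)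
      have h1 := finrank_eq_of_smul_mem le_sup_left hs'
      have h2 := latticeVol_le_of_smul_mem le_sup_left hs'
      refine ⟨s, hsY.trans (Finset.subset_insert _ _), by omega, hvol.trans ?_⟩
      have := (latticeVol_pos (Λ ⊔ Submodule.span ℤ {y t})).le
      gcongr
      refine Finset.prod_nonneg fun t' _ => ?_
      exact_mod_cast Finset.sum_nonneg fun i _ => mul_self_nonneg _

-- Pairing with `y` maps `Λ'` onto some $d\mathbb Z$. If $d\neq0$, a preimage `w` of $d$ splits `Λ'`
-- as `Λ` plus $\mathbb Zw$, and $1\le d^2\le\rho\,|y|^2$ because $d$ is an integer.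
open Matrix in
theorem exists_latticeVol_inf_orthogonal_le (Λ' : Submodule ℤ (ι → ℤ)) (y : ι → ℤ) :
    ∃ Λ : Submodule ℤ (ι → ℤ), (∀ x, x ∈ Λ ↔ x ∈ Λ' ∧ x ⬝ᵥ y = 0) ∧
      (Λ = Λ' ∨ Module.finrank ℤ Λ + 1 = Module.finrank ℤ Λ' ∧
        latticeVol Λ ^ 2 ≤ latticeVol Λ' ^ 2 * ((y ⬝ᵥ y : ℤ) : ℝ)) := by
  let f : (ι → ℤ) →ₗ[ℤ] ℤ :=
    { toFun := fun x => x ⬝ᵥ y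
      map_add' := fun a b => add_dotProduct a b y
      map_smul' := fun c a => smul_dotProduct c a y }
  have hf : ∀ x, f x = x ⬝ᵥ y := fun _ => rfl
  refine ⟨Λ' ⊓ LinearMap.ker f, fun x => Iff.rfl, ?_⟩
  by_cases hy : ∀ x ∈ Λ', f x = 0
  · exact Or.inl (inf_eq_left.mpr hy)
  right
  push Not at hy
  obtain ⟨x₀, hx₀, hfx₀⟩ := hy
  obtain ⟨d, hd⟩ := (IsPrincipalIdealRing.principal (Λ'.map f)).principal
  obtain ⟨w, hw, hwd⟩ := Submodule.mem_map.mp (hd ▸ Submodule.mem_span_singleton_self d :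
    d ∈ Λ'.map f)
  have hd0 : d ≠ 0 := by
    rintro rfl
    have : f x₀ ∈ Λ'.map f := Submodule.mem_map_of_mem hx₀
    rw [hd] at this
    simp at this
    exact hfx₀ this
  have hsup : Λ' ⊓ LinearMap.ker f ⊔ Submodule.span ℤ {w} = Λ' := by
    apply le_antisymm (sup_le inf_le_left (by simpa using hw))
    intro x hx
    have : f x ∈ Λ'.map f := Submodule.mem_map_of_mem hx
    rw [hd] at this
    obtain ⟨c, hc⟩ := Submodule.mem_span_singleton.mp this
    refine Submodule.mem_sup.mpr ⟨x - c • w, ⟨sub_mem hx (Λ'.smul_mem _ hw), ?_⟩, c • w,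
      Submodule.smul_mem _ _ (Submodule.mem_span_singleton_self w), by simp⟩
    change f (x - c • w) = 0
    rw [map_sub, map_smul, hwd, hc, sub_self]
  obtain ⟨hr, ρ, hρ, -, hρ2⟩ := exists_latticeVol_sup_span_singleton (Λ' ⊓ LinearMap.ker f) w (by
    intro m hm
    have : f (m • w) = 0 := hm.2
    rw [map_smul, hwd, smul_eq_mul] at this
    exact (mul_eq_zero.mp this).resolve_right hd0)
  rw [hsup] at hr hρ
  refine ⟨hr.symm, ?_⟩
  have h1 := hρ2 y fun x hx => hx.2
  have h2 : (1 : ℝ) ≤ ((w ⬝ᵥ y : ℤ) : ℝ) ^ 2 := by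
    have : (1 : ℤ) ≤ (w ⬝ᵥ y) ^ 2 := by
      rw [← hf, hwd]
      have := sq_pos_of_ne_zero hd0
      omega
    exact_mod_cast this
  rw [hρ, mul_assoc]
  exact le_mul_of_one_le_right (sq_nonneg _) (h2.trans h1)

open Matrix in
/-- The orthogonal complement of finitely many vectors in `Λ'` has volume at most that of `Λ'` times
the norms of some of these vectors. -/
theorem exists_latticeVol_le_of_orthogonal {τ : Type*} (y : τ → ι → ℤ) (Y : Finset τ)
    {Λ Λ' : Submodule ℤ (ι → ℤ)} (hΛ : ∀ x, x ∈ Λ ↔ x ∈ Λ' ∧ ∀ t ∈ Y, x ⬝ᵥ y t = 0) :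
    ∃ s ⊆ Y, Module.finrank ℤ Λ + s.card = Module.finrank ℤ Λ' ∧
      latticeVol Λ ^ 2 ≤ latticeVol Λ' ^ 2 * ∏ t ∈ s, ((y t ⬝ᵥ y t : ℤ) : ℝ) := by
  classical
  induction Y using Finset.induction_on generalizing Λ' with
  | empty =>
    have : Λ = Λ' := by
      ext x
      simp [hΛ]
    subst this
    exact ⟨∅, le_rfl, by simp, by simp⟩
  | insert t Y ht ih =>
    obtain ⟨Λ₁, hΛ₁, hcase⟩ := exists_latticeVol_inf_orthogonal_le Λ' (y t)
    obtain ⟨s, hsY, hcard, hvol⟩ := ih (Λ' := Λ₁) (by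
      intro x
      rw [hΛ, hΛ₁, Finset.forall_mem_insert, and_assoc])
    rcases hcase with rfl | ⟨hr, hv⟩
    · exact ⟨s, hsY.trans (Finset.subset_insert _ _), hcard, hvol⟩
    · have hts : t ∉ s := fun hts => ht (hsY hts)
      refine ⟨insert t s, Finset.insert_subset_insert _ hsY, ?_, ?_⟩
      · rw [Finset.card_insert_of_notMem hts]
        omega
      · rw [Finset.prod_insert hts, ← mul_assoc]
        refine hvol.trans ?_
        gcongr
        refine Finset.prod_nonneg fun t' _ => ?_
        exact_mod_cast Finset.sum_nonneg fun i _ => mul_self_nonneg _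

end LatticeVolume

/-- Complex and rational spans meet the lattice in the same points: independence over $\mathbb Z$
makes the integral Gram determinant nonzero, which gives independence over $\mathbb C$. -/
theorem mem_saturation_iff {ι : Type} [Fintype ι] (Λ : Submodule ℤ (ι → ℤ))
    (x : ι → ℤ) : x ∈ saturation Λ ↔ ∃ m : ℤ, m ≠ 0 ∧ m • x ∈ Λ := by
  have hmem : x ∈ saturation Λ ↔
      toHermitian x ∈ Submodule.span ℂ (toHermitian '' (Λ : Set (ι → ℤ))) := Iff.rfl
  rw [hmem]
  constructor
  · intro hx
    by_contra! hcon
    let b := Module.finBasis ℤ Λ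
    have hb : LinearIndependent ℤ fun i => (b i : ι → ℤ) :=
      b.linearIndependent.map' Λ.subtype Λ.ker_subtype
    have hspan : Submodule.span ℤ (Set.range fun i => (b i : ι → ℤ)) = Λ := by
      have := congrArg (Submodule.map Λ.subtype) b.span_eq
      rw [Submodule.map_span, Submodule.map_top, Submodule.range_subtype,
        ← Set.range_comp] at this
      exact this
    have hli : LinearIndependent ℤ (Sum.elim (fun i => (b i : ι → ℤ)) fun _ : Unit => x) := by
      refine hb.sum_type ?_ ?_
      · rw [linearIndependent_unique_iff]
        rintro rfl
        exact hcon 1 one_ne_zero (by simp)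
      · rw [hspan, Set.range_const, Submodule.disjoint_def]
        intro y hy hy2
        obtain ⟨m, rfl⟩ := Submodule.mem_span_singleton.mp hy2
        by_cases hm : m = 0
        · rw [hm, zero_smul]
        · exact absurd hy (hcon m hm)
    have hliC : LinearIndependent ℂ
        (fun i => toHermitian (Sum.elim (fun i => (b i : ι → ℤ)) (fun _ : Unit => x) i)) := by
      apply Matrix.linearIndependent_of_det_gram_ne_zero
      rw [gram_toHermitian, ← RingHom.mapMatrix_apply, ← RingHom.map_det, eq_intCast,
        Int.cast_ne_zero]
      exact (det_gram_pos hli).ne'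
    refine hliC.notMem_span_image (s := Set.range Sum.inl) (x := Sum.inr ()) (by simp) ?_
    rw [← Set.range_comp]
    refine Submodule.span_le.mpr ?_ hx
    rintro _ ⟨y, hy, rfl⟩
    have : y ∈ Submodule.span ℤ (Set.range fun i => (b i : ι → ℤ)) := by
      rw [hspan]
      exact hy
    obtain ⟨c, rfl⟩ := (Submodule.mem_span_range_iff_exists_fun ℤ).mp this
    rw [map_sum]
    refine Submodule.sum_mem _ fun i _ => ?_
    rw [map_smul, ← Int.cast_smul_eq_zsmul ℂ]
    exact Submodule.smul_mem _ _ (Submodule.subset_span ⟨i, rfl⟩)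
  · rintro ⟨m, hm, hx⟩
    have h1 : toHermitian (m • x) ∈ Submodule.span ℂ (toHermitian '' (Λ : Set (ι → ℤ))) :=
      Submodule.subset_span ⟨_, hx, rfl⟩
    rw [map_smul, ← Int.cast_smul_eq_zsmul ℂ] at h1
    exact (Submodule.smul_mem_iff _ (Int.cast_ne_zero.mpr hm)).mp h1

/-! ### Vanishing sums of roots of unity -/

theorem IsPrimitiveRoot.sum_pow_pow_eq {F : Type*} [Field F] {q : ℕ} {ω : F}
    (hω : IsPrimitiveRoot ω q) (k : ℕ) :
    ∑ s ∈ Finset.range q, (ω ^ s) ^ k = if q ∣ k then (q : F) else 0 := by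
  simp_rw [← pow_mul, mul_comm _ k, pow_mul]
  split_ifs with h
  · simp [(hω.pow_eq_one_iff_dvd k).mpr h]
  · have h1 : ω ^ k ≠ 1 := fun h1 => h ((hω.pow_eq_one_iff_dvd k).mp h1)
    rw [geom_sum_eq h1, ← pow_mul, mul_comm, pow_mul, hω.pow_eq_one, one_pow, sub_self, zero_div]

/-- The vanishing of an integral combination of powers of a primitive root of unity does not depend
on the choice of the primitive root. -/
theorem IsPrimitiveRoot.sum_pow_pow_eq_zero {F α : Type*} [Field F] [CharZero F] {m i : ℕ} {ζ : F}
    (hζ : IsPrimitiveRoot ζ m) (hm : 0 < m) (hi : i.Coprime m) (J : Finset α) (c : α → ℤ)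
    (k : α → ℕ) (h : ∑ j ∈ J, (c j : F) * ζ ^ k j = 0) :
    ∑ j ∈ J, (c j : F) * (ζ ^ i) ^ k j = 0 := by
  let f : Polynomial ℤ := ∑ j ∈ J, Polynomial.C (c j) * Polynomial.X ^ k j
  have hf : ∀ x : F, Polynomial.aeval x f = ∑ j ∈ J, (c j : F) * x ^ k j := by
    intro x
    simp [f, map_sum]
  have h1 : minpoly ℤ ζ ∣ f :=
    minpoly.isIntegrallyClosed_dvd (hζ.isIntegral hm) (by rw [hf, h])
  rw [hζ.minpoly_eq_pow_coprime hi] at h1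
  rw [← hf]
  -- $\zeta$ and $\zeta^i$ have the same minimal polynomial, and it divides `f`.
  exact Polynomial.aeval_eq_zero_of_dvd_aeval_eq_zero h1 (minpoly.aeval ℤ _)

/-- Averaging the substitutions $\zeta\mapsto\zeta^{1+ns}$, $0\le s<q$, isolates the exponents
divisible by $q$. The substituted sum vanishes whenever $1+ns$ is prime to $q$: always if $q\mid n$,
otherwise for all $s$ except at most one, which the bound on the number of terms handles. -/
theorem IsPrimitiveRoot.sum_filter_dvd_eq_zero {F α : Type*} [Field F] [CharZero F] {n q : ℕ}
    {ζ : F} (hq : q.Prime) (hn : 0 < n) (hζ : IsPrimitiveRoot ζ (n * q)) (J : Finset α) (c : α → ℤ)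
    (k : α → ℕ) (hJ : q ∣ n ∨ J.card < q) (h : ∑ j ∈ J, (c j : F) * ζ ^ k j = 0) :
    ∑ j ∈ J with q ∣ k j, (c j : F) * ζ ^ k j = 0 := by
  have hm : 0 < n * q := Nat.mul_pos hn hq.pos
  let ω := ζ ^ n
  have hω : IsPrimitiveRoot ω q := hζ.pow hm rfl
  let g : ℕ → F := fun s => ∑ j ∈ J, (c j : F) * (ζ ^ (1 + n * s)) ^ k j
  have hgω : ∀ s, g s = ∑ j ∈ J, (c j : F) * ζ ^ k j * (ω ^ s) ^ k j := by
    intro s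
    refine Finset.sum_congr rfl fun j _ => ?_
    simp only [ω]
    ring
  have hsum : ∀ e, ∑ s ∈ Finset.range q, (ω ^ s) ^ e * g s =
      q * ∑ j ∈ J with q ∣ k j + e, (c j : F) * ζ ^ k j := by
    intro e
    simp_rw [hgω, Finset.mul_sum]
    rw [Finset.sum_comm, Finset.sum_filter]
    refine Finset.sum_congr rfl fun j _ => ?_
    have h1 := hω.sum_pow_pow_eq (k j + e)
    calc ∑ s ∈ Finset.range q, (ω ^ s) ^ e * ((c j : F) * ζ ^ k j * (ω ^ s) ^ k j)
        = (c j : F) * ζ ^ k j * ∑ s ∈ Finset.range q, (ω ^ s) ^ (k j + e) := by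
          rw [Finset.mul_sum]
          refine Finset.sum_congr rfl fun s _ => ?_
          ring
      _ = _ := by
          rw [h1]
          split_ifs
          · exact mul_comm _ _
          · exact mul_zero _
  have hgood : ∀ s, ¬ q ∣ 1 + n * s → g s = 0 := by
    intro s hs
    refine hζ.sum_pow_pow_eq_zero hm ?_ J c k h
    refine Nat.Coprime.mul_right (by simp) ?_
    exact (Nat.Prime.coprime_iff_not_dvd hq).mpr hs |>.symm
  have hq0 : (q : F) ≠ 0 := Nat.cast_ne_zero.mpr hq.ne_zero
  have hall : ∀ s ∈ Finset.range q, g s = 0 := by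
    rcases hJ with hqn | hJ
    · intro s _
      refine hgood s fun hd => hq.one_lt.ne' (Nat.dvd_one.mp ?_)
      exact (Nat.dvd_add_left (hqn.mul_right s)).mp hd
    · by_contra! hcon
      obtain ⟨s₀, hs₀, hgs₀⟩ := hcon
      have hbad : q ∣ 1 + n * s₀ := by
        by_contra hb
        exact hgs₀ (hgood s₀ hb)
      have hother : ∀ s ∈ Finset.range q, s ≠ s₀ → g s = 0 := by
        intro s hs hne
        refine hgood s fun hd => hne ?_
        have hqn : IsCoprime (q : ℤ) n := by
          rw [Nat.isCoprime_iff_coprime, Nat.Prime.coprime_iff_not_dvd hq]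
          intro hqn
          exact hq.one_lt.ne' (Nat.dvd_one.mp ((Nat.dvd_add_left (hqn.mul_right s₀)).mp hbad))
        have h1 : (q : ℤ) ∣ n * ((s : ℤ) - s₀) := by
          have h2 := dvd_sub (Int.natCast_dvd_natCast.mpr hd) (Int.natCast_dvd_natCast.mpr hbad)
          push_cast at h2
          have h3 : (n : ℤ) * ((s : ℤ) - s₀) = 1 + n * s - (1 + n * s₀) := by ring
          rw [h3]
          exact h2
        have h3 := hqn.dvd_of_dvd_mul_left h1
        rw [Finset.mem_range] at hs hs₀
        have h4 := Int.eq_zero_of_abs_lt_dvd h3 (by rw [abs_lt]; constructor <;> omega)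
        omega
      -- Fewer than $q$ exponents cannot meet all residue classes. The Fourier coefficient at a
      -- missed class is zero but has only the term of $s_0$, so that term vanishes too.
      obtain ⟨e, he⟩ : ∃ e, ∀ j ∈ J, ¬ q ∣ k j + e := by
        have := Fact.mk hq
        by_contra! hcon
        have hsub : (Finset.univ : Finset (ZMod q)) ⊆ J.image fun j => -(k j : ZMod q) := by
          intro x _
          obtain ⟨j, hj, hd⟩ := hcon x.val
          refine Finset.mem_image.mpr ⟨j, hj, ?_⟩
          have := (ZMod.natCast_eq_zero_iff _ _).mpr hd
          push_cast at this
          rw [ZMod.natCast_zmod_val] at this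
          exact neg_eq_of_add_eq_zero_right this
        have := (Finset.card_le_card hsub).trans Finset.card_image_le
        rw [Finset.card_univ, ZMod.card] at this
        omega
      have h1 := hsum e
      rw [Finset.sum_eq_single_of_mem s₀ hs₀ (fun s hs hne => by rw [hother s hs hne, mul_zero]),
        Finset.filter_false_of_mem he, Finset.sum_empty, mul_zero] at h1
      refine hgs₀ ((mul_eq_zero.mp h1).resolve_left (pow_ne_zero _ (pow_ne_zero _ ?_)))
      exact hω.ne_zero hq.ne_zero
  have h1 := hsum 0
  rw [Finset.sum_eq_zero fun s hs => by rw [hall s hs, mul_zero]] at h1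
  simpa [hq0] using h1.symm

/-- A weak form of Mann's theorem: in a vanishing sum of at most `r` roots of unity with nonzero
integral coefficients, the ratio of some two of them is an `r!`-th root of unity. -/
theorem exists_pow_factorial_eq_of_sum_eq_zero {F α : Type*} [Field F] [CharZero F] [IsAlgClosed F]
    (r : ℕ) (c : α → ℤ) (u : α → F) (m : ℕ) (hm : 0 < m) (J : Finset α) (hJ : J.Nonempty)
    (hJr : J.card ≤ r) (hc : ∀ j ∈ J, c j ≠ 0) (hu : ∀ j ∈ J, u j ≠ 0)
    (hum : ∀ i ∈ J, ∀ j ∈ J, u i ^ m = u j ^ m) (hsum : ∑ j ∈ J, (c j : F) * u j = 0) :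
    ∃ i ∈ J, ∃ j ∈ J, i ≠ j ∧ u i ^ r.factorial = u j ^ r.factorial := by
  induction m using Nat.strong_induction_on generalizing J with
  | h m ih =>
  by_cases hmr : m ∣ r.factorial
  · have hcard : 1 < J.card := by
      by_contra hcon
      have h1 : J.card = 1 := le_antisymm (not_lt.mp hcon) hJ.card_pos
      obtain ⟨j, rfl⟩ := Finset.card_eq_one.mp h1
      rw [Finset.sum_singleton] at hsum
      rcases mul_eq_zero.mp hsum with h | h
      · exact hc j (by simp) (by exact_mod_cast h)
      · exact hu j (by simp) h
    obtain ⟨i, hi, j, hj, hij⟩ := Finset.one_lt_card.mp hcard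
    obtain ⟨d, hd⟩ := hmr
    exact ⟨i, hi, j, hj, hij, by rw [hd, pow_mul, pow_mul, hum i hi j hj]⟩
  -- Descent on `m`: take a prime $q$ with a higher power in `m` than in $r!$. If $q\le r$ then
  -- $q^2\mid m$; if $q>r$ there are fewer than $q$ terms. Either way the terms whose ratio to
  -- $u_{j_0}$ is an $(m/q)$-th root of unity already sum to zero.
  obtain ⟨q, hqv⟩ : ∃ q, r.factorial.factorization q < m.factorization q := by
    by_contra! hcon
    exact hmr ((Nat.factorization_le_iff_dvd hm.ne' r.factorial_ne_zero).mp hcon)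
  have hq : q.Prime := by
    by_contra hq
    rw [Nat.factorization_eq_zero_of_not_prime m hq] at hqv
    omega
  obtain ⟨n, rfl⟩ : q ∣ m := Nat.dvd_of_factorization_pos (by omega)
  have hn : 0 < n := Nat.pos_of_mul_pos_left hm
  rw [mul_comm] at hm hum
  have hcase : q ∣ n ∨ J.card < q := by
    by_cases hqr : q ≤ r
    · left
      have h1 : 0 < r.factorial.factorization q :=
        hq.factorization_pos_of_dvd r.factorial_ne_zero (hq.dvd_factorial.mpr hqr)
      rw [Nat.factorization_mul hq.ne_zero hn.ne', Finsupp.add_apply, hq.factorization_self] at hqv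
      exact Nat.dvd_of_factorization_pos (by omega)
    · right
      omega
  obtain ⟨j₀, hj₀⟩ := hJ
  have : NeZero (n * q) := ⟨hm.ne'⟩
  obtain ⟨ζ, hζ⟩ := HasEnoughRootsOfUnity.exists_primitiveRoot F (n * q)
  have hk : ∀ j, ∃ k : ℕ, j ∈ J → ζ ^ k = u j / u j₀ := by
    intro j
    by_cases hj : j ∈ J
    · obtain ⟨k, -, hk⟩ := hζ.eq_pow_of_pow_eq_one (ξ := u j / u j₀) (by
        rw [div_pow, hum j hj j₀ hj₀, div_self (pow_ne_zero _ (hu j₀ hj₀))])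
      exact ⟨k, fun _ => hk⟩
    · exact ⟨0, fun h => absurd h hj⟩
  choose k hk using hk
  have hku : ∀ j ∈ J, u j = u j₀ * ζ ^ k j := by
    intro j hj
    rw [hk j hj, mul_div_cancel₀ _ (hu j₀ hj₀)]
  have hsum' : ∑ j ∈ J, (c j : F) * ζ ^ k j = 0 := by
    have h1 : u j₀ * ∑ j ∈ J, (c j : F) * ζ ^ k j = 0 := by
      rw [← hsum, Finset.mul_sum]
      refine Finset.sum_congr rfl fun j hj => ?_
      rw [hku j hj]
      ring
    exact (mul_eq_zero.mp h1).resolve_left (hu j₀ hj₀)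
  have hfil := hζ.sum_filter_dvd_eq_zero hq hn J c k hcase hsum'
  have hj₀' : j₀ ∈ J.filter fun j => q ∣ k j := by
    refine Finset.mem_filter.mpr ⟨hj₀, ?_⟩
    have h1 := hk j₀ hj₀
    rw [div_self (hu j₀ hj₀)] at h1
    exact (Dvd.intro_left n rfl).trans ((hζ.pow_eq_one_iff_dvd _).mp h1)
  have hroot : ∀ j ∈ J.filter (fun j => q ∣ k j), u j ^ n = u j₀ ^ n := by
    intro j hj
    obtain ⟨hjJ, d, hd⟩ := Finset.mem_filter.mp hj
    rw [hku j hjJ, mul_pow, hd, ← pow_mul, mul_right_comm, mul_comm q n, pow_mul, hζ.pow_eq_one,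
      one_pow, mul_one]
  obtain ⟨i, hi, j, hj, hij⟩ := ih n (by nlinarith [hq.two_le]) hn (J.filter fun j => q ∣ k j)
    ⟨j₀, hj₀'⟩ ((Finset.card_filter_le _ _).trans hJr)
    (fun j hj => hc j (Finset.mem_filter.mp hj).1) (fun j hj => hu j (Finset.mem_filter.mp hj).1)
    (fun i hi j hj => by rw [hroot i hi, hroot j hj]) (by
      have h1 : ∑ j ∈ J with q ∣ k j, (c j : F) * u j =
          u j₀ * ∑ j ∈ J with q ∣ k j, (c j : F) * ζ ^ k j := by
        rw [Finset.mul_sum]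
        refine Finset.sum_congr rfl fun j hj => ?_
        rw [hku j (Finset.mem_filter.mp hj).1]
        ring
      rw [h1, hfil, mul_zero])
  exact ⟨i, (Finset.mem_filter.mp hi).1, j, (Finset.mem_filter.mp hj).1, hij⟩

/-! ### Comparison of the volumes of cycles and saturated boundaries -/

section RegulatorBound

variable {ι : Type} [Fintype ι]

theorem one_le_dotProduct_self {v : ι → ℤ} (hv : v ≠ 0) : (1 : ℝ) ≤ ((v ⬝ᵥ v : ℤ) : ℝ) := by
  have h0 : 0 ≤ v ⬝ᵥ v := Finset.sum_nonneg fun i _ => mul_self_nonneg _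
  have h1 : v ⬝ᵥ v ≠ 0 := fun h => hv (dotProduct_self_eq_zero.mp h)
  exact_mod_cast (by omega : 1 ≤ v ⬝ᵥ v)

theorem prod_dotProduct_self_le_pow {τ : Type*} (y : τ → ι → ℤ) (s : Finset τ) {L : ℝ} (hL : 1 ≤ L)
    (hy : ∀ t, ((y t ⬝ᵥ y t : ℤ) : ℝ) ≤ L) {h : ℕ} (hs : s.card ≤ h) :
    ∏ t ∈ s, ((y t ⬝ᵥ y t : ℤ) : ℝ) ≤ L ^ h := by
  refine (Finset.prod_le_prod (fun t _ => ?_) fun t _ => hy t).trans ?_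
  · exact_mod_cast Finset.sum_nonneg fun i _ => mul_self_nonneg _
  · rw [Finset.prod_const]
    exact pow_le_pow_right₀ hL hs

theorem prod_dotProduct_self_le_univ {τ : Type*} [Fintype τ] (v : τ → ι → ℤ) (hv : ∀ t, v t ≠ 0)
    (s : Finset τ) :
    ∏ t ∈ s, ((v t ⬝ᵥ v t : ℤ) : ℝ) ≤ ∏ t, ((v t ⬝ᵥ v t : ℤ) : ℝ) := by
  classical
  rw [← Finset.prod_sdiff (Finset.subset_univ s)]
  refine le_mul_of_one_le_left (Finset.prod_nonneg fun t _ => ?_) ?_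
  · exact zero_le_one.trans (one_le_dotProduct_self (hv t))
  · exact Finset.one_le_prod fun t _ => one_le_dotProduct_self (hv t)

variable {σ σ' τ : Type*} {Z B : Submodule ℤ (ι → ℤ)}
  {y : σ → ι → ℤ} {w : σ' → ι → ℤ} {v : τ → ι → ℤ} {L : ℝ}

theorem saturation_le_of_orthogonal (hZ : ∀ x, x ∈ Z ↔ ∀ s, x ⬝ᵥ y s = 0) (hBZ : B ≤ Z) :
    saturation B ≤ Z := by
  intro x hx
  obtain ⟨m, hm, hmx⟩ := (mem_saturation_iff B x).mp hx
  refine (hZ x).mpr fun s => ?_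
  have := (hZ _).mp (hBZ hmx) s
  rw [smul_dotProduct] at this
  exact (smul_eq_zero.mp this).resolve_left hm

theorem le_saturation (B : Submodule ℤ (ι → ℤ)) : B ≤ saturation B := fun x hx =>
  (mem_saturation_iff B x).mpr ⟨1, one_ne_zero, by rwa [one_smul]⟩

/-- The comparison passes through `Z ⊔ K`: this is generated, up to finite index, by `saturation B`
and the `v t`, while `Z` is cut out of it by the `y s`. -/
theorem latticeVol_sq_le_saturation [Fintype σ] [Fintype τ]
    (hZ : ∀ x, x ∈ Z ↔ ∀ s, x ⬝ᵥ y s = 0) (hBZ : B ≤ Z)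
    (hv : ∀ t, v t ≠ 0) (hL : 1 ≤ L) (hy : ∀ s, ((y s ⬝ᵥ y s : ℤ) : ℝ) ≤ L)
    (hspan : ∀ x ∈ Z, ∃ m : ℤ, m ≠ 0 ∧ m • x ∈ B ⊔ Submodule.span ℤ (Set.range v)) :
    latticeVol Z ^ 2 ≤ latticeVol (saturation B) ^ 2 *
      (L ^ Fintype.card τ * ∏ t, ((v t ⬝ᵥ v t : ℤ) : ℝ)) := by
  set K := Submodule.span ℤ (Set.range v) with hK
  obtain ⟨s, -, hcard, hvol⟩ := exists_latticeVol_le_of_orthogonal y Finset.univ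
    (Λ := Z) (Λ' := Z ⊔ K) (by
      intro x
      constructor
      · exact fun hx => ⟨Submodule.mem_sup_left hx, fun s _ => (hZ x).mp hx s⟩
      · exact fun hx => (hZ x).mpr fun s => hx.2 s (Finset.mem_univ s))
  obtain ⟨s', -, -, hvol'⟩ := exists_latticeVol_le_of_sup_span v Finset.univ
    (Λ := saturation B) (Λ' := Z ⊔ K) ((saturation_le_of_orthogonal hZ hBZ).trans le_sup_left)
    (fun t _ => Submodule.mem_sup_right (Submodule.subset_span ⟨t, rfl⟩)) (by
      intro x hx
      obtain ⟨z, hz, a, ha, rfl⟩ := Submodule.mem_sup.mp hx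
      obtain ⟨m, hm, hmz⟩ := hspan z hz
      refine ⟨m, hm, ?_⟩
      rw [Finset.coe_univ, Set.image_univ, smul_add]
      refine add_mem ?_ (Submodule.mem_sup_right (Submodule.smul_mem _ _ ha))
      exact sup_le_sup_right (le_saturation B) _ hmz)
  -- The number of `y s` used is the rank of `Z ⊔ K` minus that of `Z`, hence at most the number of
  -- the `v t`, however many `y s` there are.
  have hs : s.card ≤ Fintype.card τ := by
    obtain ⟨r, -, hr, -⟩ := exists_latticeVol_le_of_sup_span v Finset.univ
      (Λ := Z) (Λ' := Z ⊔ K) le_sup_left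
      (fun t _ => Submodule.mem_sup_right (Submodule.subset_span ⟨t, rfl⟩))
      (fun x hx => ⟨1, one_ne_zero, by rwa [one_smul, Finset.coe_univ, Set.image_univ]⟩)
    have := r.card_le_univ
    omega
  have hL0 : 0 ≤ L := zero_le_one.trans hL
  calc latticeVol Z ^ 2 ≤ latticeVol (Z ⊔ K) ^ 2 * ∏ t ∈ s, ((y t ⬝ᵥ y t : ℤ) : ℝ) := hvol
    _ ≤ latticeVol (Z ⊔ K) ^ 2 * L ^ Fintype.card τ := by
        gcongr
        exact prod_dotProduct_self_le_pow y s hL hy hs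
    _ ≤ (latticeVol (saturation B) ^ 2 * ∏ t ∈ s', ((v t ⬝ᵥ v t : ℤ) : ℝ)) *
          L ^ Fintype.card τ := by gcongr
    _ ≤ (latticeVol (saturation B) ^ 2 * ∏ t, ((v t ⬝ᵥ v t : ℤ) : ℝ)) *
          L ^ Fintype.card τ := by
        exact mul_le_mul_of_nonneg_right (mul_le_mul_of_nonneg_left
          (prod_dotProduct_self_le_univ v hv s') (sq_nonneg _)) (pow_nonneg hL0 _)
    _ = _ := by ring

/-- Dual to `latticeVol_sq_le_saturation`: the comparison passes through the cycles orthogonal to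
all `v t`, from which `saturation B` is recovered up to finite index by adjoining some `w s`. -/
theorem latticeVol_saturation_sq_le [Fintype σ'] [Fintype τ]
    (hZ : ∀ x, x ∈ Z ↔ ∀ s, x ⬝ᵥ y s = 0) (hBZ : B ≤ Z)
    (hB : B = Submodule.span ℤ (Set.range w))
    (hv : ∀ t, v t ≠ 0) (hL : 1 ≤ L) (hw : ∀ s, ((w s ⬝ᵥ w s : ℤ) : ℝ) ≤ L)
    (horth : ∀ x ∈ Z, (∀ t, x ⬝ᵥ v t = 0) → ∃ m : ℤ, m ≠ 0 ∧ m • x ∈ B) :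
    latticeVol (saturation B) ^ 2 ≤ latticeVol Z ^ 2 *
      (L ^ Fintype.card τ * ∏ t, ((v t ⬝ᵥ v t : ℤ) : ℝ)) := by
  let M : Submodule ℤ (ι → ℤ) :=
    { carrier := {x | x ∈ Z ∧ ∀ t, x ⬝ᵥ v t = 0}
      add_mem' := fun {a b} ha hb => ⟨add_mem ha.1 hb.1, fun t => by
        rw [add_dotProduct, ha.2, hb.2, add_zero]⟩
      zero_mem' := ⟨zero_mem _, fun t => zero_dotProduct _⟩
      smul_mem' := fun c a ha => ⟨Z.smul_mem c ha.1, fun t => by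
        rw [smul_dotProduct, ha.2, smul_zero]⟩ }
  obtain ⟨s, -, hcard, hvol⟩ := exists_latticeVol_le_of_orthogonal v Finset.univ
    (Λ := M) (Λ' := Z) (by
      intro x
      simp only [Finset.mem_univ, true_imp_iff]
      exact Iff.rfl)
  obtain ⟨s', -, hcard', hvol'⟩ := exists_latticeVol_le_of_sup_span w Finset.univ
    (Λ := M) (Λ' := saturation B)
    (fun x hx => (mem_saturation_iff B x).mpr (horth x hx.1 hx.2))
    (fun t _ => le_saturation B (hB ▸ Submodule.subset_span ⟨t, rfl⟩)) (by
      intro x hx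
      obtain ⟨m, hm, hmx⟩ := (mem_saturation_iff B x).mp hx
      refine ⟨m, hm, Submodule.mem_sup_right ?_⟩
      rw [Finset.coe_univ, Set.image_univ, ← hB]
      exact hmx)
  have hs' : s'.card ≤ Fintype.card τ := by
    have h1 := Submodule.finrank_mono (saturation_le_of_orthogonal hZ hBZ)
    have h2 := s.card_le_univ
    omega
  have hL0 : 0 ≤ L := zero_le_one.trans hL
  calc latticeVol (saturation B) ^ 2 ≤ latticeVol M ^ 2 * ∏ t ∈ s', ((w t ⬝ᵥ w t : ℤ) : ℝ) := hvol'
    _ ≤ latticeVol M ^ 2 * L ^ Fintype.card τ := by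
        gcongr
        exact prod_dotProduct_self_le_pow w s' hL hw hs'
    _ ≤ (latticeVol Z ^ 2 * ∏ t ∈ s, ((v t ⬝ᵥ v t : ℤ) : ℝ)) * L ^ Fintype.card τ := by gcongr
    _ ≤ (latticeVol Z ^ 2 * ∏ t, ((v t ⬝ᵥ v t : ℤ) : ℝ)) * L ^ Fintype.card τ := by
        exact mul_le_mul_of_nonneg_right (mul_le_mul_of_nonneg_left
          (prod_dotProduct_self_le_univ v hv s) (sq_nonneg _)) (pow_nonneg hL0 _)
    _ = _ := by ring

/-- If the lattice of cycles `Z` and the lattice of boundaries `B` are equal up to finite index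
modulo the span of vectors `v t`, and on the orthogonal complement of these vectors, then the
regulator is bounded in terms of the norms of the `v t`. -/
theorem abs_log_latticeVol_div_le [Fintype σ] [Fintype σ'] [Fintype τ]
    (hZ : ∀ x, x ∈ Z ↔ ∀ s, x ⬝ᵥ y s = 0) (hBZ : B ≤ Z)
    (hB : B = Submodule.span ℤ (Set.range w)) (hv : ∀ t, v t ≠ 0) (hL : 1 ≤ L)
    (hy : ∀ s, ((y s ⬝ᵥ y s : ℤ) : ℝ) ≤ L) (hw : ∀ s, ((w s ⬝ᵥ w s : ℤ) : ℝ) ≤ L)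
    (hspan : ∀ x ∈ Z, ∃ m : ℤ, m ≠ 0 ∧ m • x ∈ B ⊔ Submodule.span ℤ (Set.range v))
    (horth : ∀ x ∈ Z, (∀ t, x ⬝ᵥ v t = 0) → ∃ m : ℤ, m ≠ 0 ∧ m • x ∈ B) :
    |Real.log (latticeVol Z / latticeVol (saturation B))| ≤
      ∑ t, (Real.log L + Real.log ((v t ⬝ᵥ v t : ℤ) : ℝ)) := by
  have h1 := latticeVol_sq_le_saturation hZ hBZ hv hL hy hspan
  have h2 := latticeVol_saturation_sq_le hZ hBZ hB hv hL hw horth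
  have hz := latticeVol_pos Z
  have hb := latticeVol_pos (saturation B)
  have hL0 : 0 < L := zero_lt_one.trans_le hL
  have hP : (0 : ℝ) < ∏ t, ((v t ⬝ᵥ v t : ℤ) : ℝ) :=
    Finset.prod_pos fun t _ => zero_lt_one.trans_le (one_le_dotProduct_self (hv t))
  have hC : 0 < L ^ Fintype.card τ * ∏ t, ((v t ⬝ᵥ v t : ℤ) : ℝ) :=
    mul_pos (pow_pos hL0 _) hP
  have hlogC : Real.log (L ^ Fintype.card τ * ∏ t, ((v t ⬝ᵥ v t : ℤ) : ℝ)) =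
      ∑ t, (Real.log L + Real.log ((v t ⬝ᵥ v t : ℤ) : ℝ)) := by
    rw [Real.log_mul (pow_pos hL0 _).ne' hP.ne', Real.log_pow, Real.log_prod
      (fun t _ => (zero_lt_one.trans_le (one_le_dotProduct_self (hv t))).ne'),
      Finset.sum_add_distrib, Finset.sum_const, Finset.card_univ, nsmul_eq_mul]
  have h0 : 0 ≤ ∑ t, (Real.log L + Real.log ((v t ⬝ᵥ v t : ℤ) : ℝ)) :=
    Finset.sum_nonneg fun t _ =>
      add_nonneg (Real.log_nonneg hL) (Real.log_nonneg (one_le_dotProduct_self (hv t)))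
  have h1' := Real.log_le_log (pow_pos hz 2) h1
  have h2' := Real.log_le_log (pow_pos hb 2) h2
  rw [Real.log_mul (pow_pos hb 2).ne' hC.ne', hlogC, Real.log_pow, Real.log_pow] at h1'
  rw [Real.log_mul (pow_pos hz 2).ne' hC.ne', hlogC, Real.log_pow, Real.log_pow] at h2'
  rw [Real.log_div hz.ne' hb.ne', abs_le]
  push_cast at h1' h2'
  constructor <;> linarith

end RegulatorBound

/-! ### Contracting homotopies up to denominators -/

/-- Over a field there is `g` with $DgD=D$; then $1-gD$ lands in $\ker D\subseteq\operatorname{im}A$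
and lifts through `A`. -/
theorem exists_matrix_homotopy {F α β γ : Type*} [Field F] [Fintype α] [Fintype β] [Fintype γ]
    [DecidableEq α] [DecidableEq β] [DecidableEq γ] (A : Matrix β γ F) (D : Matrix α β F)
    (h : ∀ x, D.mulVec x = 0 → ∃ z, A.mulVec z = x) :
    ∃ (P : Matrix γ β F) (Q : Matrix β α F), A * P + Q * D = 1 := by
  obtain ⟨r, hr⟩ := D.mulVecLin.rangeRestrict.exists_rightInverse_of_surjective
    (LinearMap.range_rangeRestrict _)
  obtain ⟨g, hg⟩ := LinearMap.exists_extend r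
  have hDg : ∀ x, D.mulVec (g (D.mulVec x)) = D.mulVec x := by
    intro x
    have h1 : g (D.mulVec x) = r (D.mulVecLin.rangeRestrict x) := by
      rw [← hg]
      rfl
    rw [h1]
    exact congrArg Subtype.val (LinearMap.congr_fun hr (D.mulVecLin.rangeRestrict x))
  let f : (β → F) →ₗ[F] LinearMap.range A.mulVecLin :=
    (LinearMap.id - g ∘ₗ D.mulVecLin).codRestrict _ fun x => by
      obtain ⟨z, hz⟩ := h (x - g (D.mulVec x)) (by rw [Matrix.mulVec_sub, hDg, sub_self])
      exact ⟨z, hz⟩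
  obtain ⟨s, hs⟩ := Module.projective_lifting_property A.mulVecLin.rangeRestrict f
    A.mulVecLin.surjective_rangeRestrict
  refine ⟨LinearMap.toMatrix' s, LinearMap.toMatrix' g, ?_⟩
  apply Matrix.toLin'.injective
  ext1 x
  apply LinearMap.ext
  intro t
  have h1 : A.mulVec (s (Pi.single x t)) = Pi.single x t - g (D.mulVec (Pi.single x t)) :=
    congrArg Subtype.val (LinearMap.congr_fun hs (Pi.single x t))
  simp [Matrix.toLin'_mul, h1]

theorem exists_matrix_homotopy_of_fractionRing {R α β γ : Type*} [CommRing R] [IsDomain R]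
    [Fintype α] [Fintype β] [Fintype γ] [DecidableEq β]
    (A : Matrix β γ R) (D : Matrix α β R)
    (h : ∀ x, (D.map (algebraMap R (FractionRing R))).mulVec x = 0 →
      ∃ z, (A.map (algebraMap R (FractionRing R))).mulVec z = x) :
    ∃ p : R, p ≠ 0 ∧ ∃ (P : Matrix γ β R) (Q : Matrix β α R), A * P + Q * D = p • 1 := by
  classical
  obtain ⟨P, Q, hPQ⟩ := exists_matrix_homotopy _ _ h
  obtain ⟨p, hp⟩ := IsLocalization.exist_integer_multiples_of_finite (nonZeroDivisors R)
    (Sum.elim (fun x : γ × β => P x.1 x.2) fun x : β × α => Q x.1 x.2)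
  choose P' hP' using fun i j => hp (Sum.inl (i, j))
  choose Q' hQ' using fun i j => hp (Sum.inr (i, j))
  refine ⟨p, nonZeroDivisors.ne_zero p.2, Matrix.of P', Matrix.of Q', ?_⟩
  apply Matrix.map_injective (IsFractionRing.injective R (FractionRing R))
  have h1 : (Matrix.of P').map (algebraMap R (FractionRing R)) = (p : R) • P := by
    ext i j
    exact hP' i j
  have h2 : (Matrix.of Q').map (algebraMap R (FractionRing R)) = (p : R) • Q := by
    ext i j
    exact hQ' i j
  change (A * Matrix.of P' + Matrix.of Q' * D).map (algebraMap R (FractionRing R)) =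
    ((p : R) • (1 : Matrix β β R)).map (algebraMap R (FractionRing R))
  rw [Matrix.map_add _ (map_add _), Matrix.map_mul, Matrix.map_mul, h1, h2, Matrix.mul_smul,
    Matrix.smul_mul, ← smul_add, hPQ]
  ext i j
  rw [Matrix.map_apply, Matrix.smul_apply, Matrix.smul_apply, Matrix.one_apply, Matrix.one_apply]
  split_ifs <;> simp [Algebra.smul_def]

/-! ### Ideals of integral group rings of finite abelian groups -/

section GroupRing

open AddMonoidAlgebra

open Classical in
/-- The sum of the elements of a subgroup in the integral group ring. -/
def normElement {G : Type*} [AddCommGroup G] [Fintype G] (H : AddSubgroup G) :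
    AddMonoidAlgebra ℤ G :=
  ∑ h with h ∈ H, single h 1

/-- The elements of the group which detect the zeros of `p` among the torsion characters. -/
def torsionDirections {X : Type*} [AddCommGroup X] (p : AddMonoidAlgebra ℤ X) : Set X :=
  {a | ∃ x ∈ p.coeff.support, ∃ y ∈ p.coeff.support,
    x ≠ y ∧ a = p.coeff.support.card.factorial • (x - y)}

theorem torsionDirections_finite {X : Type*} [AddCommGroup X] (p : AddMonoidAlgebra ℤ X) :
    (torsionDirections p).Finite := by
  classical
  refine ((p.coeff.support ×ˢ p.coeff.support).image fun z =>
    p.coeff.support.card.factorial • (z.1 - z.2)).finite_toSet.subset ?_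
  rintro a ⟨x, hx, y, hy, -, rfl⟩
  simp only [Finset.coe_image, Set.mem_image, Finset.mem_coe, Finset.mem_product]
  exact ⟨(x, y), ⟨hx, hy⟩, rfl⟩

theorem ne_zero_of_mem_torsionDirections {X : Type*} [AddCommGroup X] [IsAddTorsionFree X]
    {p : AddMonoidAlgebra ℤ X} {a : X} (ha : a ∈ torsionDirections p) : a ≠ 0 := by
  obtain ⟨x, -, y, -, hxy, rfl⟩ := ha
  rw [smul_ne_zero_iff_right (Nat.factorial_ne_zero _)]
  exact sub_ne_zero.mpr hxy

/-- Otherwise some prime ideal contains the ideal and no nonzero integer, which yields a character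
`χ` of `G` in characteristic zero killing all the generators. The vanishing of `p` is then a
vanishing sum of roots of unity, so $\chi(\varphi(a))=1$ for a torsion direction `a`; but then `χ`
sends its norm element to the order of $\varphi(a)$, which is nonzero. -/
theorem exists_intCast_mem_span_normElement {X G : Type*} [AddCommGroup X] [AddCommGroup G]
    [Fintype G] (φ : X →+ G) {p : AddMonoidAlgebra ℤ X} (hp : p ≠ 0) :
    ∃ m : ℤ, m ≠ 0 ∧ (m : AddMonoidAlgebra ℤ G) ∈ Ideal.span (insert (mapDomainRingHom ℤ φ p)
      ((fun a => normElement (AddSubgroup.zmultiples (φ a))) '' torsionDirections p)) := by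
  classical
  set I := Ideal.span (insert (mapDomainRingHom ℤ φ p)
    ((fun a => normElement (AddSubgroup.zmultiples (φ a))) '' torsionDirections p)) with hI
  by_contra! hcon
  obtain ⟨P, hP, hIP, hdisj⟩ := Ideal.exists_le_prime_disjoint I
    ((nonZeroDivisors ℤ).map (Int.castRingHom (AddMonoidAlgebra ℤ G))) (by
      rw [Set.disjoint_left]
      rintro _ hx ⟨m, hm, rfl⟩
      exact hcon m (nonZeroDivisors.ne_zero hm) hx)
  have hchar : CharZero (AddMonoidAlgebra ℤ G ⧸ P) := by
    refine charZero_of_inj_zero fun n hn => ?_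
    by_contra hn0
    have hmem : (n : AddMonoidAlgebra ℤ G) ∈ P :=
      Ideal.Quotient.eq_zero_iff_mem.mp (by rw [map_natCast, hn])
    exact Set.disjoint_left.mp hdisj hmem
      ⟨n, mem_nonZeroDivisors_of_ne_zero (by exact_mod_cast hn0), by simp⟩
  let F := AlgebraicClosure (FractionRing (AddMonoidAlgebra ℤ G ⧸ P))
  have hcharK : CharZero (FractionRing (AddMonoidAlgebra ℤ G ⧸ P)) :=
    IsFractionRing.charZero_of_isFractionRing (AddMonoidAlgebra ℤ G ⧸ P)
  have hcharF : CharZero F :=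
    charZero_of_injective_algebraMap (algebraMap (FractionRing (AddMonoidAlgebra ℤ G ⧸ P)) F).injective
  let χ : AddMonoidAlgebra ℤ G →+* F :=
    (algebraMap (FractionRing (AddMonoidAlgebra ℤ G ⧸ P)) F).comp
      ((algebraMap (AddMonoidAlgebra ℤ G ⧸ P) _).comp (Ideal.Quotient.mk P))
  have hχI : ∀ f ∈ I, χ f = 0 := by
    intro f hf
    have : Ideal.Quotient.mk P f = 0 := Ideal.Quotient.eq_zero_iff_mem.mpr (hIP hf)
    simp [χ, this]
  let u : X → F := fun x => χ (single (φ x) 1)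
  have hpow : ∀ (g : G) (n : ℕ), χ (single g 1) ^ n = χ (single (n • g) 1) := by
    intro g n
    rw [← map_pow, single_pow, one_pow]
  have hone : χ (single 0 1) = 1 := by
    rw [← one_def, map_one]
  have hcard : ∀ x, u x ^ Fintype.card G = 1 := by
    intro x
    rw [hpow, card_nsmul_eq_zero, hone]
  have hu : ∀ x, u x ≠ 0 := by
    intro x hx
    have := hcard x
    rw [hx, zero_pow Fintype.card_ne_zero] at this
    exact zero_ne_one this
  have hsum : ∑ x ∈ p.coeff.support, (p.coeff x : F) * u x = 0 := by
    rw [← hχI _ (Ideal.subset_span (Set.mem_insert _ _))]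
    conv_rhs => rw [← sum_coeff_single p, Finsupp.sum, map_sum, map_sum]
    refine Finset.sum_congr rfl fun x _ => ?_
    have : mapDomainRingHom ℤ φ (single x (p.coeff x)) =
        (p.coeff x : AddMonoidAlgebra ℤ G) * single (φ x) 1 := by
      rw [intCast_def, single_mul_single]
      simp
    rw [this, map_mul, map_intCast]
  obtain ⟨x, hx, y, hy, hxy, hu_eq⟩ := exists_pow_factorial_eq_of_sum_eq_zero
    p.coeff.support.card (fun x => p.coeff x) u (Fintype.card G) Fintype.card_pos p.coeff.support
    (by
      rw [Finsupp.support_nonempty_iff]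
      simpa using hp) le_rfl
    (fun x hx => Finsupp.mem_support_iff.mp hx) (fun x _ => hu x)
    (fun x _ y _ => by rw [hcard, hcard]) hsum
  let a := p.coeff.support.card.factorial • (x - y)
  have ha : a ∈ torsionDirections p := ⟨x, hx, y, hy, hxy, rfl⟩
  have hχa : χ (single (φ a) 1) = 1 := by
    have h1 : χ (single (φ a) 1) * u y ^ p.coeff.support.card.factorial =
        u x ^ p.coeff.support.card.factorial := by
      rw [hpow, hpow, ← map_mul, single_mul_single, ← map_nsmul, ← map_nsmul, ← map_add, mul_one]
      congr 4
      simp [a, smul_sub]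
    rw [hu_eq] at h1
    exact mul_right_cancel₀ (pow_ne_zero _ (hu y)) (h1.trans (one_mul _).symm)
  have hnorm : χ (normElement (AddSubgroup.zmultiples (φ a))) =
      ((Finset.univ.filter fun h => h ∈ AddSubgroup.zmultiples (φ a)).card : F) := by
    rw [normElement, map_sum, Finset.card_eq_sum_ones, Nat.cast_sum]
    refine Finset.sum_congr rfl fun h hh => ?_
    obtain ⟨n, rfl⟩ := mem_multiples_iff_mem_zmultiples.mpr (Finset.mem_filter.mp hh).2
    change χ (single (n • φ a) 1) = _
    rw [← hpow, hχa, one_pow, Nat.cast_one]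
  rw [hχI _ (Ideal.subset_span (Set.mem_insert_of_mem _ ⟨a, ha, rfl⟩))] at hnorm
  have h0 := Nat.cast_eq_zero.mp hnorm.symm
  rw [Finset.card_eq_zero, Finset.filter_eq_empty_iff] at h0
  exact h0 (Finset.mem_univ 0) (zero_mem _)

/-! ### Restriction of scalars from the group ring to the integers -/

variable {G : Type} [AddCommGroup G] [Fintype G] [DecidableEq G]

/-- The free module on `α × G` over `ℤ` as the free module on `α` over the group ring. -/
def groupRingEquiv (α : Type*) : (α → AddMonoidAlgebra ℤ G) ≃ₗ[ℤ] (α × G → ℤ) where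
  toFun x i := (x i.1).coeff i.2
  invFun z i := ∑ g, single g (z (i, g))
  map_add' x y := by
    ext i
    simp
  map_smul' c x := by
    ext i
    exact coeff_smul_apply c (x i.1) i.2
  left_inv x := by
    ext i g
    simp
  right_inv z := by
    ext i
    simp [Finsupp.single_apply]

/-- The integral matrix of a matrix over the group ring. -/
def integralMatrix {α β : Type*} (A : Matrix α β (AddMonoidAlgebra ℤ G)) :
    Matrix (α × G) (β × G) ℤ :=
  Matrix.of fun p q => Algebra.leftMulMatrix (AddMonoidAlgebra.basis G ℤ) (A p.1 q.1) p.2 q.2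

theorem integralMatrix_apply {α β : Type*} (A : Matrix α β (AddMonoidAlgebra ℤ G)) (p : α × G)
    (q : β × G) : integralMatrix A p q = (A p.1 q.1).coeff (p.2 - q.2) := by
  rw [integralMatrix, Matrix.of_apply, Algebra.leftMulMatrix_eq_repr_mul]
  change (A p.1 q.1 * AddMonoidAlgebra.basis G ℤ q.2).coeff p.2 = _
  rw [AddMonoidAlgebra.basis_apply, coeff_mul_single_apply, mul_one, sub_eq_add_neg]

theorem integralMatrix_mulVec {α β : Type*} [Fintype β] (A : Matrix α β (AddMonoidAlgebra ℤ G))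
    (x : β → AddMonoidAlgebra ℤ G) :
    (integralMatrix A).mulVec (groupRingEquiv β x) = groupRingEquiv α (A.mulVec x) := by
  ext ⟨i, g⟩
  have h : ∀ a b : AddMonoidAlgebra ℤ G, (a * b).coeff g = ∑ h, a.coeff (g - h) * b.coeff h := by
    intro a b
    rw [coeff_mul_apply_right, Finsupp.sum_fintype _ _ (by simp)]
    simp [sub_eq_add_neg]
  simp only [Matrix.mulVec, dotProduct, integralMatrix_apply, Fintype.sum_prod_type, groupRingEquiv,
    LinearEquiv.coe_mk, LinearMap.coe_mk, AddHom.coe_mk]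
  rw [coeff_sum, Finset.sum_apply']
  simp [h]

end GroupRing

/-! ### Coset vectors and the regulator bound over a finite quotient -/

section FiniteLevel

open AddMonoidAlgebra

variable {G : Type} [AddCommGroup G] [Fintype G]

theorem coeff_normElement (H : AddSubgroup G) [DecidablePred (· ∈ H)] (g : G) :
    (normElement H).coeff g = if g ∈ H then 1 else 0 := by
  classical
  rw [normElement, coeff_sum, Finset.sum_apply']
  simp [Finsupp.single_apply, Finset.sum_ite_eq']

open Classical in
/-- The indicator vector of a coset of `H` in one of the components of `ℤ^(α × G)`. -/
def cosetVector {α : Type*} (H : AddSubgroup G) (t : α × (G ⧸ H)) : α × G → ℤ :=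
  fun i => if i.1 = t.1 ∧ (i.2 : G ⧸ H) = t.2 then 1 else 0

theorem dotProduct_cosetVector {α : Type*} [Fintype α] (H : AddSubgroup G) [DecidableEq (G ⧸ H)]
    (z : α × G → ℤ) (t : α × (G ⧸ H)) :
    z ⬝ᵥ cosetVector H t = ∑ h ∈ Finset.univ.filter (fun h : G => (h : G ⧸ H) = t.2), z (t.1, h) := by
  classical
  rw [dotProduct, Fintype.sum_prod_type, Finset.sum_eq_single_of_mem t.1 (Finset.mem_univ _),
    Finset.sum_filter]
  · refine Finset.sum_congr rfl fun h _ => ?_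
    simp [cosetVector]
  · intro j _ hj
    refine Finset.sum_eq_zero fun h _ => ?_
    simp [cosetVector, hj]

theorem dotProduct_cosetVector_self {α : Type*} [Fintype α] (H : AddSubgroup G)
    (t : α × (G ⧸ H)) :
    (cosetVector H t : α × G → ℤ) ⬝ᵥ cosetVector H t = Nat.card H := by
  classical
  rw [dotProduct_cosetVector]
  have h1 : ∀ h ∈ Finset.univ.filter (fun h : G => (h : G ⧸ H) = t.2),
      (cosetVector H t : α × G → ℤ) (t.1, h) = 1 := by
    intro h hh
    simp [cosetVector, (Finset.mem_filter.mp hh).2]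
  rw [Finset.sum_congr rfl h1, Finset.sum_const, nsmul_eq_mul, mul_one, Nat.cast_inj,
    Nat.card_eq_fintype_card, ← Finset.card_univ]
  obtain ⟨g, hg⟩ := QuotientAddGroup.mk_surjective t.2
  symm
  refine Finset.card_bij (fun h _ => g + (h : G)) ?_ ?_ ?_
  · intro h _
    simp only [Finset.mem_filter, Finset.mem_univ, true_and]
    rw [← hg, QuotientAddGroup.eq]
    simp
  · intro h _ h' _ hh
    exact Subtype.ext (add_left_cancel hh)
  · intro k hk
    have hk' := (Finset.mem_filter.mp hk).2
    rw [← hg, eq_comm, QuotientAddGroup.eq] at hk'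
    exact ⟨⟨_, hk'⟩, Finset.mem_univ _, by simp⟩

variable [DecidableEq G]

/-- Multiplication by the norm element replaces each coordinate by the sum over its coset. The
formula shows both that the image lies in the span of the coset vectors and that vectors orthogonal
to them are killed. -/
theorem groupRingEquiv_normElement_smul {α : Type*} [Fintype α] (H : AddSubgroup G)
    [Fintype (G ⧸ H)] (x : α → AddMonoidAlgebra ℤ G) :
    groupRingEquiv α (normElement H • x) =
      ∑ t : α × (G ⧸ H), (groupRingEquiv α x ⬝ᵥ cosetVector H t) • cosetVector H t := by
  classical
  ext ⟨i, g⟩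
  have h1 : (groupRingEquiv α (normElement H • x)) (i, g) =
      (normElement H * x i).coeff g := rfl
  rw [h1, coeff_mul_apply_right, Finsupp.sum_fintype _ _ (by simp), Finset.sum_apply,
    Finset.sum_eq_single_of_mem (i, (g : G ⧸ H)) (Finset.mem_univ _)]
  · rw [Pi.smul_apply, dotProduct_cosetVector, Finset.sum_filter]
    simp only [cosetVector, and_self, if_true, smul_eq_mul, mul_one]
    refine Finset.sum_congr rfl fun h _ => ?_
    have hiff : g + -h ∈ H ↔ (h : G ⧸ H) = g := by rw [QuotientAddGroup.eq, add_comm]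
    rw [coeff_normElement]
    by_cases hg : (h : G ⧸ H) = g
    · rw [if_pos hg, if_pos (hiff.mpr hg), one_mul]
      rfl
    · rw [if_neg hg, if_neg (hg ∘ hiff.mp), zero_mul]
  · rintro ⟨j, c⟩ _ hjc
    rw [Pi.smul_apply]
    have : (cosetVector H (j, c) : α × G → ℤ) (i, g) = 0 := by
      rw [cosetVector, if_neg]
      rintro ⟨rfl, rfl⟩
      exact hjc rfl
    rw [this, smul_zero]

/-- The sum of the absolute values of the coefficients of a Laurent polynomial. -/
def coeffNorm {X : Type*} (q : AddMonoidAlgebra ℤ X) : ℤ :=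
  ∑ x ∈ q.coeff.support, |q.coeff x|

theorem coeffNorm_nonneg {X : Type*} (q : AddMonoidAlgebra ℤ X) : 0 ≤ coeffNorm q :=
  Finset.sum_nonneg fun _ _ => abs_nonneg _

/-- The bound does not depend on `G`; this makes the constant in the regulator estimate uniform in
`Γ`. -/
theorem sum_abs_coeff_mapDomain_le {X : Type*} [AddCommGroup X] (φ : X →+ G)
    (q : AddMonoidAlgebra ℤ X) :
    ∑ g, |(mapDomainRingHom ℤ φ q).coeff g| ≤ coeffNorm q := by
  have h1 : ∀ g, (mapDomainRingHom ℤ φ q).coeff g =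
      ∑ x ∈ q.coeff.support, if φ x = g then q.coeff x else 0 := by
    intro g
    conv_lhs => rw [← sum_coeff_single q, Finsupp.sum, map_sum, coeff_sum, Finset.sum_apply']
    refine Finset.sum_congr rfl fun x _ => ?_
    simp [Finsupp.single_apply]
  calc ∑ g, |(mapDomainRingHom ℤ φ q).coeff g|
      ≤ ∑ g, ∑ x ∈ q.coeff.support, if φ x = g then |q.coeff x| else 0 := by
        refine Finset.sum_le_sum fun g _ => ?_
        rw [h1]
        refine (Finset.abs_sum_le_sum_abs _ _).trans (Finset.sum_le_sum fun x _ => ?_)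
        split_ifs <;> simp
    _ = coeffNorm q := by
        rw [Finset.sum_comm, coeffNorm]
        simp

theorem sum_sq_row_integralMatrix_le {X α β : Type*} [AddCommGroup X] [Fintype β] (φ : X →+ G)
    (M : Matrix α β (AddMonoidAlgebra ℤ X)) (p : α × G) :
    (fun q => integralMatrix (M.map (mapDomainRingHom ℤ φ)) p q) ⬝ᵥ
      (fun q => integralMatrix (M.map (mapDomainRingHom ℤ φ)) p q) ≤
        (∑ j, coeffNorm (M p.1 j)) ^ 2 := by
  have h1 := Finset.sum_sq_le_sq_sum_of_nonneg (s := Finset.univ)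
    (f := fun q => |integralMatrix (M.map (mapDomainRingHom ℤ φ)) p q|) fun _ _ => abs_nonneg _
  simp only [sq_abs] at h1
  refine (le_of_eq ?_).trans (h1.trans (pow_le_pow_left₀ (Finset.sum_nonneg fun _ _ => abs_nonneg _)
    ?_ 2))
  · simp [dotProduct, pow_two]
  · rw [Fintype.sum_prod_type]
    refine Finset.sum_le_sum fun j _ => ?_
    simp only [integralMatrix_apply, Matrix.map_apply]
    exact (le_of_eq ((Equiv.subLeft p.2).sum_comp fun g =>
      |(mapDomainRingHom ℤ φ (M p.1 j)).coeff g|)).trans (sum_abs_coeff_mapDomain_le φ _)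

theorem sum_sq_col_integralMatrix_le {X α β : Type*} [AddCommGroup X] [Fintype α] (φ : X →+ G)
    (M : Matrix α β (AddMonoidAlgebra ℤ X)) (q : β × G) :
    (fun p => integralMatrix (M.map (mapDomainRingHom ℤ φ)) p q) ⬝ᵥ
      (fun p => integralMatrix (M.map (mapDomainRingHom ℤ φ)) p q) ≤
        (∑ i, coeffNorm (M i q.1)) ^ 2 := by
  have h1 := Finset.sum_sq_le_sq_sum_of_nonneg (s := Finset.univ)
    (f := fun p => |integralMatrix (M.map (mapDomainRingHom ℤ φ)) p q|) fun _ _ => abs_nonneg _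
  simp only [sq_abs] at h1
  refine (le_of_eq ?_).trans (h1.trans (pow_le_pow_left₀ (Finset.sum_nonneg fun _ _ => abs_nonneg _)
    ?_ 2))
  · simp [dotProduct, pow_two]
  · rw [Fintype.sum_prod_type]
    refine Finset.sum_le_sum fun i _ => ?_
    simp only [integralMatrix_apply, Matrix.map_apply]
    exact (le_of_eq ((Equiv.subRight q.2).sum_comp fun g =>
      |(mapDomainRingHom ℤ φ (M i q.1)).coeff g|)).trans (sum_abs_coeff_mapDomain_le φ _)

/-- An upper bound for the squared norms of the rows and of the columns of all integral matrices
induced by a matrix over the group ring. -/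
def matrixNormBound {X α β : Type*} [Fintype α] [Fintype β]
    (M : Matrix α β (AddMonoidAlgebra ℤ X)) : ℝ :=
  -- The summand 1 keeps the bound at least 1, so that its logarithm is nonnegative.
  1 + ((∑ i, ∑ j, coeffNorm (M i j) : ℤ) : ℝ) ^ 2

theorem row_integralMatrix_le {X α β : Type*} [AddCommGroup X] [Fintype α] [Fintype β] (φ : X →+ G)
    (M : Matrix α β (AddMonoidAlgebra ℤ X)) (p : α × G) :
    (((fun q => integralMatrix (M.map (mapDomainRingHom ℤ φ)) p q) ⬝ᵥ
      (fun q => integralMatrix (M.map (mapDomainRingHom ℤ φ)) p q) : ℤ) : ℝ) ≤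
        matrixNormBound M := by
  have h1 := sum_sq_row_integralMatrix_le φ M p
  have h2 : ∑ j, coeffNorm (M p.1 j) ≤ ∑ i, ∑ j, coeffNorm (M i j) :=
    Finset.single_le_sum (f := fun i => ∑ j, coeffNorm (M i j))
      (fun i _ => Finset.sum_nonneg fun j _ => coeffNorm_nonneg _) (Finset.mem_univ p.1)
  have h3 := pow_le_pow_left₀ (Finset.sum_nonneg fun j _ => coeffNorm_nonneg (M p.1 j)) h2 2
  have h4 := h1.trans h3
  have h5 : (((fun q => integralMatrix (M.map (mapDomainRingHom ℤ φ)) p q) ⬝ᵥ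
      (fun q => integralMatrix (M.map (mapDomainRingHom ℤ φ)) p q) : ℤ) : ℝ) ≤
      (((∑ i, ∑ j, coeffNorm (M i j)) ^ 2 : ℤ) : ℝ) := by exact_mod_cast h4
  rw [Int.cast_pow] at h5
  rw [matrixNormBound]
  linarith

theorem col_integralMatrix_le {X α β : Type*} [AddCommGroup X] [Fintype α] [Fintype β] (φ : X →+ G)
    (M : Matrix α β (AddMonoidAlgebra ℤ X)) (q : β × G) :
    (((fun p => integralMatrix (M.map (mapDomainRingHom ℤ φ)) p q) ⬝ᵥ
      (fun p => integralMatrix (M.map (mapDomainRingHom ℤ φ)) p q) : ℤ) : ℝ) ≤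
        matrixNormBound M := by
  have h1 := sum_sq_col_integralMatrix_le φ M q
  have h2 : ∑ i, coeffNorm (M i q.1) ≤ ∑ i, ∑ j, coeffNorm (M i j) :=
    Finset.sum_le_sum fun i _ => Finset.single_le_sum (f := fun j => coeffNorm (M i j))
      (fun j _ => coeffNorm_nonneg _) (Finset.mem_univ q.1)
  have h3 := pow_le_pow_left₀ (Finset.sum_nonneg fun i _ => coeffNorm_nonneg (M i q.1)) h2 2
  have h4 := h1.trans h3
  have h5 : (((fun p => integralMatrix (M.map (mapDomainRingHom ℤ φ)) p q) ⬝ᵥ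
      (fun p => integralMatrix (M.map (mapDomainRingHom ℤ φ)) p q) : ℤ) : ℝ) ≤
      (((∑ i, ∑ j, coeffNorm (M i j)) ^ 2 : ℤ) : ℝ) := by exact_mod_cast h4
  rw [Int.cast_pow] at h5
  rw [matrixNormBound]
  linarith

/-- The bound for the regulator at a finite quotient `G` of the group `X`, in terms of the orders of
the images in `G` of finitely many elements of `X`. -/
theorem abs_log_latticeVol_div_saturation_le {X α : Type*} {β γ : Type} [AddCommGroup X]
    [Fintype α] [Fintype β] [Fintype γ] [DecidableEq β] (φ : X →+ G)
    {A : Matrix β γ (AddMonoidAlgebra ℤ X)} {D : Matrix α β (AddMonoidAlgebra ℤ X)}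
    (hDA : D * A = 0) {p : AddMonoidAlgebra ℤ X} (hp : p ≠ 0)
    {P : Matrix γ β (AddMonoidAlgebra ℤ X)} {Q : Matrix β α (AddMonoidAlgebra ℤ X)}
    (hPQ : A * P + Q * D = p • 1) {Z : Submodule ℤ (β × G → ℤ)}
    (hZ : ∀ x, x ∈ Z ↔ (integralMatrix (D.map (mapDomainRingHom ℤ φ))).mulVec x = 0) :
    |Real.log (latticeVol Z / latticeVol (saturation
        (LinearMap.range (integralMatrix (A.map (mapDomainRingHom ℤ φ))).mulVecLin)))| ≤
      ∑ a ∈ (torsionDirections_finite p).toFinset, Fintype.card β *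
        ((Fintype.card G : ℝ) / addOrderOf (φ a)) *
          (Real.log (matrixNormBound A + matrixNormBound D) + Real.log (addOrderOf (φ a))) := by
  classical
  set ψ := mapDomainRingHom ℤ φ with hψ
  set T := (torsionDirections_finite p).toFinset with hT
  set B := LinearMap.range (integralMatrix (A.map ψ)).mulVecLin with hB
  let H : X → AddSubgroup G := fun a => AddSubgroup.zmultiples (φ a)
  let v : (Σ a : T, β × (G ⧸ H a)) → β × G → ℤ := fun t => cosetVector (H t.1) t.2
  let K := Submodule.span ℤ (Set.range v)
  have hvv : ∀ t, v t ⬝ᵥ v t = addOrderOf (φ t.1) := by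
    intro t
    rw [dotProduct_cosetVector_self, Nat.card_zmultiples]
  have hv0 : ∀ t, v t ≠ 0 := by
    intro t ht
    have := hvv t
    rw [ht, zero_dotProduct] at this
    exact (addOrderOf_pos (φ t.1)).ne (by exact_mod_cast this)
  have hmapsmul : ∀ x, (A.map ψ).mulVec ((P.map ψ).mulVec x) +
      (Q.map ψ).mulVec ((D.map ψ).mulVec x) = ψ p • x := by
    intro x
    rw [Matrix.mulVec_mulVec, Matrix.mulVec_mulVec, ← Matrix.add_mulVec, ← Matrix.map_mul,
      ← Matrix.map_mul, ← Matrix.map_add _ (map_add _), hPQ]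
    have : (p • (1 : Matrix β β (AddMonoidAlgebra ℤ X))).map ψ = ψ p • 1 := by
      ext1 i j
      rw [Matrix.map_apply, Matrix.smul_apply, Matrix.smul_apply, Matrix.one_apply,
        Matrix.one_apply, smul_eq_mul, smul_eq_mul, map_mul]
      split_ifs <;> simp
    rw [this, Matrix.smul_mulVec, Matrix.one_mulVec]
  have hZ' : ∀ x, groupRingEquiv β x ∈ Z ↔ (D.map ψ).mulVec x = 0 := by
    intro x
    rw [hZ, integralMatrix_mulVec, LinearEquiv.map_eq_zero_iff]
  have hBmem : ∀ x, groupRingEquiv β ((A.map ψ).mulVec x) ∈ B := by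
    intro x
    exact ⟨groupRingEquiv γ x, integralMatrix_mulVec _ x⟩
  have hBmem' : ∀ x, groupRingEquiv β x ∈ B → ∃ y, (A.map ψ).mulVec y = x := by
    rintro x ⟨y, hy⟩
    refine ⟨(groupRingEquiv γ).symm y, (groupRingEquiv β).injective ?_⟩
    rw [← hy, ← integralMatrix_mulVec, LinearEquiv.apply_symm_apply]
    rfl
  have hBZ : B ≤ Z := by
    intro x hx
    obtain ⟨x, rfl⟩ := (groupRingEquiv β).surjective x
    obtain ⟨y, rfl⟩ := hBmem' x hx
    rw [hZ', Matrix.mulVec_mulVec, ← Matrix.map_mul, hDA, Matrix.map_zero _ (map_zero _),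
      Matrix.zero_mulVec]
  have hp_mem : ∀ x, groupRingEquiv β x ∈ Z → groupRingEquiv β (ψ p • x) ∈ B := by
    intro x hx
    rw [← hmapsmul, (hZ' x).mp hx, Matrix.mulVec_zero, add_zero]
    exact hBmem _
  obtain ⟨m, hm, hmI⟩ := exists_intCast_mem_span_normElement φ hp
  have hmsmul : ∀ x : β → AddMonoidAlgebra ℤ G,
      groupRingEquiv β ((m : AddMonoidAlgebra ℤ G) • x) = m • groupRingEquiv β x := by
    intro x
    rw [Int.cast_smul_eq_zsmul, map_smul]
  have hspan : ∀ x ∈ Z, ∃ m : ℤ, m ≠ 0 ∧ m • x ∈ B ⊔ K := by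
    have key : ∀ f ∈ Ideal.span (insert (ψ p)
        ((fun a => normElement (AddSubgroup.zmultiples (φ a))) '' torsionDirections p)),
        ∀ x, groupRingEquiv β x ∈ Z → groupRingEquiv β (f • x) ∈ B ⊔ K := by
      intro f hf
      induction hf using Submodule.span_induction with
      | mem f hf =>
        intro x hx
        rcases hf with rfl | ⟨a, ha, rfl⟩
        · exact Submodule.mem_sup_left (hp_mem x hx)
        · refine Submodule.mem_sup_right ?_
          simp only
          rw [groupRingEquiv_normElement_smul]
          refine Submodule.sum_mem _ fun t _ => Submodule.smul_mem _ _ (Submodule.subset_span ?_)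
          exact ⟨⟨⟨a, by simpa [hT] using ha⟩, t⟩, rfl⟩
      | zero =>
        intro x _
        rw [zero_smul, map_zero]
        exact zero_mem _
      | add f g _ _ hf hg =>
        intro x hx
        rw [add_smul, map_add]
        exact add_mem (hf x hx) (hg x hx)
      -- Cycles are stable under the group ring, so `g` can be moved onto `x`.
      | smul g f _ hf =>
        intro x hx
        rw [smul_eq_mul, mul_comm, mul_smul]
        refine hf _ ?_
        rw [hZ', Matrix.mulVec_smul, (hZ' x).mp hx, smul_zero]
    intro x hx
    obtain ⟨x, rfl⟩ := (groupRingEquiv β).surjective x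
    exact ⟨m, hm, hmsmul x ▸ key _ hmI x hx⟩
  have horth : ∀ x ∈ Z, (∀ t, x ⬝ᵥ v t = 0) → ∃ m : ℤ, m ≠ 0 ∧ m • x ∈ B := by
    intro x hx hxv
    obtain ⟨x, rfl⟩ := (groupRingEquiv β).surjective x
    have key : ∀ f ∈ Ideal.span (insert (ψ p)
        ((fun a => normElement (AddSubgroup.zmultiples (φ a))) '' torsionDirections p)),
        groupRingEquiv β (f • x) ∈ B := by
      intro f hf
      induction hf using Submodule.span_induction with
      | mem f hf =>
        rcases hf with rfl | ⟨a, ha, rfl⟩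
        · exact hp_mem x hx
        · simp only
          rw [groupRingEquiv_normElement_smul, Finset.sum_eq_zero]
          · exact zero_mem _
          · intro t _
            have := hxv ⟨⟨a, by simpa [hT] using ha⟩, t⟩
            simp only [v, H] at this
            rw [this, zero_smul]
      | zero =>
        rw [zero_smul, map_zero]
        exact zero_mem _
      | add f g _ _ hf hg =>
        rw [add_smul, map_add]
        exact add_mem hf hg
      | smul g f _ hf =>
        obtain ⟨y, hy⟩ := hBmem' _ hf
        rw [smul_eq_mul, mul_smul, ← hy, ← Matrix.mulVec_smul]
        exact hBmem _
    exact ⟨m, hm, hmsmul x ▸ key _ hmI⟩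
  have hA1 : 1 ≤ matrixNormBound A := by
    rw [matrixNormBound]
    linarith [sq_nonneg ((∑ i, ∑ j, coeffNorm (A i j) : ℤ) : ℝ)]
  have hD1 : 1 ≤ matrixNormBound D := by
    rw [matrixNormBound]
    linarith [sq_nonneg ((∑ i, ∑ j, coeffNorm (D i j) : ℤ) : ℝ)]
  have hmain := abs_log_latticeVol_div_le (Z := Z) (B := B)
    (y := fun p q => integralMatrix (D.map ψ) p q) (w := fun q p => integralMatrix (A.map ψ) p q)
    (v := v) (L := matrixNormBound A + matrixNormBound D)
    (by
      intro x
      rw [hZ, funext_iff]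
      refine forall_congr' fun s => ?_
      rw [dotProduct_comm]
      rfl) hBZ
    (by
      rw [hB, Matrix.range_mulVecLin]
      rfl) hv0 (by linarith)
    (fun s => (row_integralMatrix_le φ D s).trans (by linarith))
    (fun s => (col_integralMatrix_le φ A s).trans (by linarith)) hspan horth
  refine hmain.trans (le_of_eq ?_)
  -- For each `a` the number of coset vectors is the rank times the index of the cyclic subgroup
  -- generated by $\varphi(a)$.
  rw [Fintype.sum_sigma, ← Finset.sum_coe_sort T]
  refine Finset.sum_congr rfl fun a _ => ?_
  have h1 : ∀ t : β × (G ⧸ H a), Real.log ((v ⟨a, t⟩ ⬝ᵥ v ⟨a, t⟩ : ℤ) : ℝ) =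
      Real.log (addOrderOf (φ a)) := by
    intro t
    rw [hvv]
    simp
  simp_rw [h1]
  rw [Finset.sum_const, nsmul_eq_mul, Finset.card_univ, Fintype.card_prod, Nat.cast_mul]
  congr 2
  rw [eq_div_iff (by exact_mod_cast (addOrderOf_pos (φ a)).ne')]
  have h2 := AddSubgroup.card_eq_card_quotient_mul_card_addSubgroup (H a)
  rw [Nat.card_zmultiples, Nat.card_eq_fintype_card, Nat.card_eq_fintype_card] at h2
  exact_mod_cast h2.symm

end FiniteLevel

/-! ### Subgroups of large girth -/

theorem wordLength_lt_top {G : Type*} [AddGroup G] {S : Set G} (hS : AddSubgroup.closure S = ⊤)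
    (x : G) : wordLength S x < ⊤ := by
  have hmem : x ∈ AddSubmonoid.closure (S ∪ -S) := by
    rw [← AddSubgroup.closure_toAddSubmonoid, AddSubgroup.mem_toAddSubmonoid, hS]
    trivial
  obtain ⟨l, hl, hx⟩ := AddSubmonoid.exists_list_of_mem_closure hmem
  refine lt_of_le_of_lt ?_ (ENat.natCast_lt_top l.length)
  exact iInf_le_of_le l (iInf_le_of_le hl (iInf_le_of_le hx le_rfl))

theorem eventually_notMem_of_girth {G κ : Type*} [AddGroup G] {S : Set G}
    (hS : AddSubgroup.closure S = ⊤) (Γ : κ → AddSubgroup G) {x : G} (hx : x ≠ 0) :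
    ∀ᶠ i in comap (fun i => girth S (Γ i)) (𝓝 ⊤), x ∉ Γ i := by
  have h1 : ∀ᶠ c : ℕ∞ in 𝓝 ⊤, wordLength S x < c := lt_mem_nhds (wordLength_lt_top hS x)
  filter_upwards [h1.comap fun i => girth S (Γ i)] with i hi hxi
  exact absurd (iInf_le_of_le x (iInf_le_of_le hxi (iInf_le_of_le hx le_rfl))) (not_le.mpr hi)

/-- If the order of `a` is below `b`, some $ja$ with $1\le j<b$ lies in `Γ i`. These are finitely
many nonzero elements, each of finite word length, so large girth excludes them. -/
theorem tendsto_addOrderOf_mk_of_girth {G κ : Type*} [AddCommGroup G] [IsAddTorsionFree G]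
    {S : Set G} (hS : AddSubgroup.closure S = ⊤) (Γ : κ → AddSubgroup G)
    (hΓ : ∀ i, (Γ i).FiniteIndex) {a : G} (ha : a ≠ 0) :
    Tendsto (fun i => addOrderOf (QuotientAddGroup.mk' (Γ i) a))
      (comap (fun i => girth S (Γ i)) (𝓝 ⊤)) atTop := by
  rw [tendsto_atTop]
  intro b
  have h1 : ∀ j ∈ Finset.Ico 1 b,
      ∀ᶠ i in comap (fun i => girth S (Γ i)) (𝓝 ⊤), j • a ∉ Γ i := by
    intro j hj
    refine eventually_notMem_of_girth hS Γ ?_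
    rw [smul_ne_zero_iff_right (by have := Finset.mem_Ico.mp hj; omega)]
    exact ha
  filter_upwards [(Finset.eventually_all _).mpr h1] with i hi
  by_contra! hlt
  have := hΓ i
  -- Finite index matters here: `addOrderOf` takes the value 0 on elements of infinite order.
  have hpos : 0 < addOrderOf (QuotientAddGroup.mk' (Γ i) a) := addOrderOf_pos _
  refine hi _ (Finset.mem_Ico.mpr ⟨hpos, hlt⟩) ?_
  have h2 := addOrderOf_nsmul_eq_zero (QuotientAddGroup.mk' (Γ i) a)
  rw [← map_nsmul] at h2
  exact (QuotientAddGroup.eq_zero_iff _).mp h2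

theorem tendsto_const_add_log_div_atTop (c : ℝ) :
    Tendsto (fun n : ℕ => (c + Real.log n) / n) atTop (𝓝 0) := by
  have h1 : Tendsto (fun n : ℕ => c / (n : ℝ)) atTop (𝓝 0) :=
    tendsto_const_div_atTop_nhds_zero_nat c
  have h2 : Tendsto (fun n : ℕ => Real.log n / (n : ℝ)) atTop (𝓝 0) := by
    have := Real.isLittleO_log_id_atTop.tendsto_div_nhds_zero
    exact this.comp tendsto_natCast_atTop_atTop
  simpa [add_div] using h1.add h2

/-! ### Regulators of the quotient complexes -/

namespace BasedFreeComplex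

theorem exists_mulVec_eq_of_subsingleton_homology {R : Type*} [CommRing R] (C : BasedFreeComplex R)
    (k : ℕ) (h : Subsingleton (C.homology k)) {x : C.ι k → R} (hx : x ∈ C.cycles k) :
    ∃ z, (C.d k).mulVec z = x := by
  have h1 : (⟨x, hx⟩ : C.cycles k) ∈ (C.boundaries k).submoduleOf (C.cycles k) := by
    rw [← Submodule.Quotient.mk_eq_zero]
    exact Subsingleton.elim _ _
  exact h1

end BasedFreeComplex

-- The matrix `D` stands for the boundary map out of degree `k`, so that degree 0, which has no
-- matrix of its own, is covered together with the others.
open AddMonoidAlgebra in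
open Classical in
theorem tendsto_log_regulator_div_index {n : ℕ}
    (C : BasedFreeComplex (AddMonoidAlgebra ℤ (Fin n → ℤ))) (k : ℕ) {α : Type} [Fintype α]
    (D : Matrix α (C.ι k) (AddMonoidAlgebra ℤ (Fin n → ℤ))) (hDA : D * C.d k = 0)
    (hD : ∀ x, (D.map (algebraMap _ (FractionRing (AddMonoidAlgebra ℤ (Fin n → ℤ))))).mulVec x = 0 →
      ∃ z, ((C.d k).map (algebraMap _ (FractionRing (AddMonoidAlgebra ℤ (Fin n → ℤ))))).mulVec z = x)
    (hZ : ∀ (Γ : AddSubgroup (Fin n → ℤ)) [Γ.FiniteIndex] (x : C.ι k × ((Fin n → ℤ) ⧸ Γ) → ℤ),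
      letI : Fintype ((Fin n → ℤ) ⧸ Γ) := Fintype.ofFinite _
      x ∈ (C.quotientComplex Γ).cycles k ↔ (integralMatrix
        (D.map (mapDomainRingHom ℤ (QuotientAddGroup.mk' Γ)))).mulVec x = 0)
    {S : Set (Fin n → ℤ)} (hS : AddSubgroup.closure S = ⊤) :
    Tendsto
      (fun Γ : {Γ : AddSubgroup (Fin n → ℤ) // Γ.FiniteIndex} =>
        haveI : Γ.1.FiniteIndex := Γ.2
        Real.log ((C.quotientComplex Γ.1).regulator k) / (Γ.1.index : ℝ))
      (comap (fun Γ : {Γ : AddSubgroup (Fin n → ℤ) // Γ.FiniteIndex} => girth S Γ.1) (𝓝 ⊤))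
      (𝓝 0) := by
  obtain ⟨p, hp, P, Q, hPQ⟩ := exists_matrix_homotopy_of_fractionRing (C.d k) D hD
  set T := (torsionDirections_finite p).toFinset with hT
  let L := matrixNormBound (C.d k) + matrixNormBound D
  have hlim : Tendsto (fun Γ : {Γ : AddSubgroup (Fin n → ℤ) // Γ.FiniteIndex} =>
      ∑ a ∈ T, (Fintype.card (C.ι k) : ℝ) * ((Real.log L +
        Real.log (addOrderOf (QuotientAddGroup.mk' Γ.1 a))) /
          addOrderOf (QuotientAddGroup.mk' Γ.1 a)))
      (comap (fun Γ : {Γ : AddSubgroup (Fin n → ℤ) // Γ.FiniteIndex} => girth S Γ.1) (𝓝 ⊤))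
      (𝓝 0) := by
    rw [← Finset.sum_const_zero (s := T)]
    refine tendsto_finsetSum _ fun a ha => ?_
    have ha0 : a ≠ 0 :=
      ne_zero_of_mem_torsionDirections ((torsionDirections_finite p).mem_toFinset.mp ha)
    have h1 := (tendsto_const_add_log_div_atTop (Real.log L)).comp
      (tendsto_addOrderOf_mk_of_girth hS
        (fun Γ : {Γ : AddSubgroup (Fin n → ℤ) // Γ.FiniteIndex} => Γ.1) (fun Γ => Γ.2) ha0)
    simpa using h1.const_mul (Fintype.card (C.ι k) : ℝ)
  refine squeeze_zero_norm (fun Γ => ?_) hlim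
  have hfin : Γ.1.FiniteIndex := Γ.2
  let : Fintype ((Fin n → ℤ) ⧸ Γ.1) := Fintype.ofFinite _
  have hindex : Γ.1.index = Fintype.card ((Fin n → ℤ) ⧸ Γ.1) := by
    rw [AddSubgroup.index, Nat.card_eq_fintype_card]
  have hpos : (0 : ℝ) < Fintype.card ((Fin n → ℤ) ⧸ Γ.1) := by
    exact_mod_cast Fintype.card_pos
  have hbound : |Real.log ((C.quotientComplex Γ.1).regulator k)| ≤ _ :=
    abs_log_latticeVol_div_saturation_le (QuotientAddGroup.mk' Γ.1) hDA hp hPQ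
      (Z := (C.quotientComplex Γ.1).cycles k) (hZ Γ.1)
  rw [Real.norm_eq_abs, abs_div, hindex, abs_of_pos hpos, div_le_iff₀ hpos, Finset.sum_mul]
  refine hbound.trans (le_of_eq (Finset.sum_congr rfl fun a _ => ?_))
  simp only [L]
  ring

/-- Neighbourhoods of `⊤` in `ℕ∞` contain all $c\ge N$ for some finite $N$, including `⊤`, so
convergence along the pulled-back filter is the stated $\varepsilon$–$N$ condition. -/
theorem theorem2 (n : ℕ) (C : BasedFreeComplex (AddMonoidAlgebra ℤ (Fin n → ℤ))) (k : ℕ)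
    (hk : Subsingleton ((C.baseChange (algebraMap (AddMonoidAlgebra ℤ (Fin n → ℤ))
      (FractionRing (AddMonoidAlgebra ℤ (Fin n → ℤ))))).homology k))
    (S : Finset (Fin n → ℤ)) (hS : AddSubgroup.closure (S : Set (Fin n → ℤ)) = ⊤) :
    Tendsto
      (fun Γ : {Γ : AddSubgroup (Fin n → ℤ) // Γ.FiniteIndex} =>
        haveI : Γ.1.FiniteIndex := Γ.2
        Real.log ((C.quotientComplex Γ.1).regulator k) / (Γ.1.index : ℝ))
      (comap (fun Γ : {Γ : AddSubgroup (Fin n → ℤ) // Γ.FiniteIndex} =>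
        girth (S : Set (Fin n → ℤ)) Γ.1) (𝓝 ⊤))
      (𝓝 0) := by
  cases k with
  | zero =>
    -- In degree 0 the outgoing map is the matrix without rows, whose kernel is everything.
    refine tendsto_log_regulator_div_index C 0
      (0 : Matrix PEmpty (C.ι 0) (AddMonoidAlgebra ℤ (Fin n → ℤ))) (Matrix.zero_mul _)
      (fun x _ => BasedFreeComplex.exists_mulVec_eq_of_subsingleton_homology _ 0 hk
        (x := x) Submodule.mem_top) ?_ hS
    intro Γ _ x
    exact ⟨fun _ => funext fun i => i.1.elim, fun _ => trivial⟩
  | succ k =>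
    refine tendsto_log_regulator_div_index C (k + 1) (C.d k) (C.d_mul_d k)
      (fun x hx => BasedFreeComplex.exists_mulVec_eq_of_subsingleton_homology _ (k + 1) hk
        (x := x) hx) ?_ hS
    intro Γ _ x
    exact Iff.rfl

end
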